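/- Algebras are associative complex algebras, not necessarily unital. $B_1\sqcup B_2$ denotes the free product (the coproduct in the category of algebras) with embeddings $i_1,i_2$; for homomorphisms $j_k:B_k\to D$ let $j_1\sqcup j_2:B_1\sqcup B_2\to D$ be the homomorphism with $(j_1\sqcup j_2)\circ i_k=j_k$, and for $j_k:C_k\to B_k$ let $j_1\amalg j_2=(i_1\circ j_1)\sqcup(i_2\circ j_2)$. If $B_1,B_2$ are $*$-algebras, so is $B_1\sqcup B_2$. Fix a $\odot$-independence: an assignment which sends linear functionals $\phi_1,\phi_2$ on algebras $B_1,B_2$ to a linear functional $\phi_1\odot\phi_2$ on $B_1\sqcup B_2$ such that (A1) $(\phi_1\odot\phi_2)\circ i_k=\phi_k$ for $k=1,2$; (A2) $(\phi_1\odot\phi_2)\odot\phi_3=\phi_1\odot(\phi_2\odot\phi_3)$; (A3) $(\phi_1\circ j_1)\odot(\phi_2\circ j_2)=(\phi_1\odot\phi_2)\circ(j_1\amalg j_2)$ for all algebra homomorphisms $j_k:C_k\to B_k$. A dual semigroup is a $*$-algebra $B$ with a $*$-homomorphism $\Delta:B\to B\sqcup B$ such that $(\Delta\amalg\mathrm{id})\circ\Delta=(\mathrm{id}\amalg\Delta)\circ\Delta$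 and $(0\sqcup\mathrm{id})\circ\Delta=\mathrm{id}=(\mathrm{id}\sqcup0)\circ\Delta$. For linear functionals on $B$ put $\phi_1\star\phi_2=(\phi_1\odot\phi_2)\circ\Delta$, let $\phi^{\star 0}=0$ (the zero functional is the unit of $\star$) and $\phi^{\star(n+1)}=\phi^{\star n}\star\phi$. For a vector space $V$ let $S(V)$ be its symmetric algebra, and for a linear functional $\phi$ on $V$ let $S(\phi):S(V)\to\mathbb C$ be the unital algebra homomorphism extending $\phi$. Put $D(\phi)(x)=\frac{d}{dt}S(t\phi)(x)\big|_{t=0}$ for $x\in S(V)$. For a dual semigroup $B$ let $\sigma:B\sqcup B\to S(B)\otimes S(B)$ be the linear map with $\phi_1\odot\phi_2=(S(\phi_1)\otimes S(\phi_2))\circ\sigma$ for all linear functionals $\phi_1,\phi_2$ on $B$, and let $\Delta_S:S(B)\to S(B)\otimes S(B)$ be the unital algebra homomorphism extending $\sigma\circ\Delta$. For linear functionals $f,g$ on $S(B)$ put $f\star g=(f\otimes g)\circ\Delta_S$ and $f^{\star0}=S(0)$, $f^{\star(n+1)}=f^{\star n}\star f$. For a linear functional $\psi$ on $B$, the convolution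 exponential is the linear functional on $B$ given by $$(\exp_\star\psi)(b)=\sum_{n=0}^\infty\frac{D(\psi)^{\star n}(b)}{n!},\qquad b\in B.$$ **Proposition.** Let $B$ and $C$ be dual semigroups, let $\kappa:C\to B$ be a $*$-algebra homomorphism, and let $\psi$ be a linear functional on $B$. For all $t\ge0$ the convolution exponentials $\gamma_t=\exp_\star(t\psi)$ on $B$ and $\varphi_t=\exp_\star(t(\psi\circ\kappa))$ on $C$ are well defined (a map $\sigma$ exists, the series converge, and the sums are uniquely determined linear functionals), and $$(\gamma_{t/n}\circ\kappa)^{\star n}(c)\longrightarrow\varphi_t(c)\quad(n\to\infty)\qquad\text{for all }t\ge0\text{ and }c\in C.$$ -/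

import Mathlib

open scoped TensorProduct Topology

universe u v w

set_option linter.unusedSectionVars false

/-! Algebras are associative complex algebras, not necessarily unital. -/

/-! ## The free product of two algebras -/

namespace FreeProd

variable (A : Type u) (B : Type v)
  [NonUnitalRing A] [Module ℂ A] [IsScalarTower ℂ A A] [SMulCommClass ℂ A A]
  [NonUnitalRing B] [Module ℂ B] [IsScalarTower ℂ B B] [SMulCommClass ℂ B B]

/-- The relations identifying the products of two letters of the same algebra with their product in
that algebra. -/
inductive Rel : TensorAlgebra ℂ (A × B) → TensorAlgebra ℂ (A × B) → Prop
  | inl_mul (a a' : A) : Rel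
      (TensorAlgebra.ι ℂ ((a, 0) : A × B) * TensorAlgebra.ι ℂ ((a', 0) : A × B))
      (TensorAlgebra.ι ℂ ((a * a', 0) : A × B))
  | inr_mul (b b' : B) : Rel
      (TensorAlgebra.ι ℂ ((0, b) : A × B) * TensorAlgebra.ι ℂ ((0, b') : A × B))
      (TensorAlgebra.ι ℂ ((0, b * b') : A × B))

/-- The unital algebra `ℂ 1 ⊕ (A ⊔ B)`: the unital algebra generated by the vector space `A ⊕ B`
subject to the relations above. -/
abbrev Unital : Type (max u v) := RingQuot (Rel A B)

/-- A pair of elements of `A` and `B` as an element of `ℂ 1 ⊕ (A ⊔ B)`. -/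
noncomputable def gen : A × B →ₗ[ℂ] Unital A B :=
  (RingQuot.mkAlgHom ℂ (Rel A B)).toLinearMap ∘ₗ TensorAlgebra.ι ℂ

/-- `A ⊔ B` as the non-unital subalgebra of `ℂ 1 ⊕ (A ⊔ B)` generated by `A` and `B`. -/
noncomputable def carrier : NonUnitalSubalgebra ℂ (Unital A B) :=
  NonUnitalAlgebra.adjoin ℂ (Set.range (gen A B))

end FreeProd

/-- The free product `A ⊔ B` of two (not necessarily unital) complex algebras, that is, their
coproduct in the category of algebras; see `FreeProd.inl`, `FreeProd.inr`, `FreeProd.lift` and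
`FreeProd.hom_ext`. -/
def FreeProd (A : Type u) (B : Type v)
    [NonUnitalRing A] [Module ℂ A] [IsScalarTower ℂ A A] [SMulCommClass ℂ A A]
    [NonUnitalRing B] [Module ℂ B] [IsScalarTower ℂ B B] [SMulCommClass ℂ B B] : Type (max u v) :=
  FreeProd.carrier A B

namespace FreeProd

section Instances

variable (A : Type u) (B : Type v)
  [NonUnitalRing A] [Module ℂ A] [IsScalarTower ℂ A A] [SMulCommClass ℂ A A]
  [NonUnitalRing B] [Module ℂ B] [IsScalarTower ℂ B B] [SMulCommClass ℂ B B]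

noncomputable instance : NonUnitalRing (FreeProd A B) :=
  inferInstanceAs (NonUnitalRing (carrier A B))

noncomputable instance : Module ℂ (FreeProd A B) :=
  inferInstanceAs (Module ℂ (carrier A B))

instance : IsScalarTower ℂ (FreeProd A B) (FreeProd A B) :=
  inferInstanceAs (IsScalarTower ℂ (carrier A B) (carrier A B))

instance : SMulCommClass ℂ (FreeProd A B) (FreeProd A B) :=
  inferInstanceAs (SMulCommClass ℂ (carrier A B) (carrier A B))

end Instances

variable {A : Type u} {B : Type v} {D : Type w}
  [NonUnitalRing A] [Module ℂ A] [IsScalarTower ℂ A A] [SMulCommClass ℂ A A]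
  [NonUnitalRing B] [Module ℂ B] [IsScalarTower ℂ B B] [SMulCommClass ℂ B B]
  [NonUnitalRing D] [Module ℂ D] [IsScalarTower ℂ D D] [SMulCommClass ℂ D D]

/-- The inclusion of `A ⊔ B` into `ℂ 1 ⊕ (A ⊔ B)`. -/
noncomputable def incl : FreeProd A B →ₙₐ[ℂ] Unital A B :=
  NonUnitalSubalgebraClass.subtype (carrier A B)

theorem incl_injective : Function.Injective (incl : FreeProd A B → Unital A B) :=
  Subtype.val_injective

theorem gen_inl_mul (a a' : A) :
    gen A B (a * a', 0) = gen A B (a, 0) * gen A B (a', 0) := by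
  simp only [gen, LinearMap.comp_apply, AlgHom.toLinearMap_apply]
  rw [← map_mul]
  exact (RingQuot.mkAlgHom_rel ℂ (Rel.inl_mul a a')).symm

theorem gen_inr_mul (b b' : B) :
    gen A B (0, b * b') = gen A B (0, b) * gen A B (0, b') := by
  simp only [gen, LinearMap.comp_apply, AlgHom.toLinearMap_apply]
  rw [← map_mul]
  exact (RingQuot.mkAlgHom_rel ℂ (Rel.inr_mul b b')).symm

/-- The natural embedding of `A` into `A ⊔ B`. -/
noncomputable def inl : A →ₙₐ[ℂ] FreeProd A B where
  toFun a := ⟨gen A B (a, 0), NonUnitalAlgebra.subset_adjoin ℂ ⟨_, rfl⟩⟩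
  map_smul' c a := Subtype.ext <| by
    change gen A B (c • a, 0) = c • gen A B (a, 0)
    rw [← map_smul]; simp
  map_zero' := Subtype.ext <| by
    change gen A B (0, 0) = 0
    exact map_zero (gen A B)
  map_add' a a' := Subtype.ext <| by
    change gen A B (a + a', 0) = gen A B (a, 0) + gen A B (a', 0)
    rw [← map_add]; simp
  map_mul' a a' := Subtype.ext (gen_inl_mul a a')

/-- The natural embedding of `B` into `A ⊔ B`. -/
noncomputable def inr : B →ₙₐ[ℂ] FreeProd A B where
  toFun b := ⟨gen A B (0, b), NonUnitalAlgebra.subset_adjoin ℂ ⟨_, rfl⟩⟩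
  map_smul' c b := Subtype.ext <| by
    change gen A B (0, c • b) = c • gen A B (0, b)
    rw [← map_smul]; simp
  map_zero' := Subtype.ext <| by
    change gen A B (0, 0) = 0
    exact map_zero (gen A B)
  map_add' b b' := Subtype.ext <| by
    change gen A B (0, b + b') = gen A B (0, b) + gen A B (0, b')
    rw [← map_add]; simp
  map_mul' b b' := Subtype.ext (gen_inr_mul b b')

theorem incl_inl (a : A) : incl (inl a : FreeProd A B) = gen A B (a, 0) := rfl

theorem incl_inr (b : B) : incl (inr b : FreeProd A B) = gen A B (0, b) := rfl

/-- The unital homomorphism from `ℂ 1 ⊕ (A ⊔ B)` to `ℂ 1 ⊕ D` which extends `f` and `g`. -/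
noncomputable def unitalLift (f : A →ₙₐ[ℂ] D) (g : B →ₙₐ[ℂ] D) :
    Unital A B →ₐ[ℂ] Unitization ℂ D :=
  RingQuot.liftAlgHom ℂ ⟨TensorAlgebra.lift ℂ
    ((Unitization.inrNonUnitalAlgHom ℂ D : D →ₗ[ℂ] Unitization ℂ D) ∘ₗ
      ((f : A →ₗ[ℂ] D).coprod (g : B →ₗ[ℂ] D))), by
    intro x y h
    cases h <;> simp⟩

theorem unitalLift_gen (f : A →ₙₐ[ℂ] D) (g : B →ₙₐ[ℂ] D) (x : A × B) :
    unitalLift f g (gen A B x) = Unitization.inr (f x.1 + g x.2) := by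
  simp [unitalLift, gen]

theorem unitalLift_fst (f : A →ₙₐ[ℂ] D) (g : B →ₙₐ[ℂ] D) (x : FreeProd A B) :
    (unitalLift f g (incl x)).fst = 0 := by
  obtain ⟨x, hx⟩ := x
  change (unitalLift f g x).fst = 0
  refine NonUnitalAlgebra.adjoin_induction
    (p := fun x _ => (unitalLift f g x).fst = 0) ?_ ?_ ?_ ?_ ?_ hx
  · rintro _ ⟨x, rfl⟩
    simp [unitalLift_gen]
  · intro x y _ _ hx hy
    simp [hx, hy]
  · simp
  · intro x y _ _ hx hy
    simp [hx]
  · intro c x _ hx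
    simp [hx]

/-- The homomorphism `f ⊔ g : A ⊔ B → D` determined by `f : A → D` and `g : B → D`. -/
noncomputable def lift (f : A →ₙₐ[ℂ] D) (g : B →ₙₐ[ℂ] D) : FreeProd A B →ₙₐ[ℂ] D where
  toFun x := (unitalLift f g (incl x)).snd
  map_smul' c x := by simp
  map_zero' := by simp
  map_add' x y := by simp
  map_mul' x y := by simp [unitalLift_fst]

@[simp] theorem lift_inl (f : A →ₙₐ[ℂ] D) (g : B →ₙₐ[ℂ] D) (a : A) :
    lift f g (inl a) = f a := by
  change (unitalLift f g (incl (inl a))).snd = f a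
  rw [incl_inl, unitalLift_gen]; simp

@[simp] theorem lift_inr (f : A →ₙₐ[ℂ] D) (g : B →ₙₐ[ℂ] D) (b : B) :
    lift f g (inr b) = g b := by
  change (unitalLift f g (incl (inr b))).snd = g b
  rw [incl_inr, unitalLift_gen]; simp

/-- The elements of `A` and of `B` generate `A ⊔ B`. -/
theorem induction {p : FreeProd A B → Prop} (hl : ∀ a, p (inl a)) (hr : ∀ b, p (inr b))
    (add : ∀ x y, p x → p y → p (x + y)) (mul : ∀ x y, p x → p y → p (x * y))
    (smul : ∀ (c : ℂ) x, p x → p (c • x)) (x : FreeProd A B) : p x := by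
  obtain ⟨x, hx⟩ := x
  refine NonUnitalAlgebra.adjoin_induction
    (p := fun x hx => p (⟨x, hx⟩ : carrier A B)) ?_ ?_ ?_ ?_ ?_ hx
  · rintro _ ⟨⟨a, b⟩, rfl⟩
    have : (⟨gen A B (a, b), NonUnitalAlgebra.subset_adjoin ℂ ⟨_, rfl⟩⟩ : carrier A B)
        = (inl a + inr b : FreeProd A B) := Subtype.ext <| by
      change gen A B (a, b) = gen A B (a, 0) + gen A B (0, b)
      rw [← map_add]; simp
    rw [this]
    exact add _ _ (hl a) (hr b)
  · intro x y hx hy h1 h2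
    exact add _ _ h1 h2
  · have h := hl 0
    rwa [map_zero] at h
  · intro x y hx hy h1 h2
    exact mul _ _ h1 h2
  · intro c x hx h
    exact smul c _ h

theorem hom_ext {F G : FreeProd A B →ₙₐ[ℂ] D} (hl : ∀ a, F (inl a) = G (inl a))
    (hr : ∀ b, F (inr b) = G (inr b)) : F = G := by
  ext x
  induction x using FreeProd.induction with
  | hl a => exact hl a
  | hr b => exact hr b
  | add x y hx hy => rw [map_add, map_add, hx, hy]
  | mul x y hx hy => rw [map_mul, map_mul, hx, hy]
  | smul c x hx => rw [map_smul, map_smul, hx]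

/-- The homomorphism `f ⨿ g : A ⊔ B → A' ⊔ B'`. -/
noncomputable def map {A' : Type*} {B' : Type*}
    [NonUnitalRing A'] [Module ℂ A'] [IsScalarTower ℂ A' A'] [SMulCommClass ℂ A' A']
    [NonUnitalRing B'] [Module ℂ B'] [IsScalarTower ℂ B' B'] [SMulCommClass ℂ B' B']
    (f : A →ₙₐ[ℂ] A') (g : B →ₙₐ[ℂ] B') : FreeProd A B →ₙₐ[ℂ] FreeProd A' B' :=
  lift (inl.comp f) (inr.comp g)

variable (A B D) in
/-- The canonical identification `(A ⊔ B) ⊔ D → A ⊔ (B ⊔ D)`. -/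
noncomputable def assoc : FreeProd (FreeProd A B) D →ₙₐ[ℂ] FreeProd A (FreeProd B D) :=
  lift (lift inl (inr.comp inl)) (inr.comp inr)

end FreeProd

/-! ## The involution of the free product -/

/-- The algebra with the same addition as `D`, with the opposite multiplication and with the complex
conjugate scalar multiplication. -/
structure ConjOp (D : Type u) where
  /-- regard an element of `D` as an element of `ConjOp D` -/
  of ::
  /-- the underlying element of `D` -/
  val : D

namespace ConjOp

variable {D : Type u} [NonUnitalRing D] [Module ℂ D]

/-- `ConjOp D` and `D` have the same elements. -/
def equiv (D : Type u) : ConjOp D ≃ D := ⟨val, of, fun _ => rfl, fun _ => rfl⟩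

instance : AddCommGroup (ConjOp D) := (equiv D).addCommGroup

instance : NonUnitalRing (ConjOp D) where
  mul x y := of (y.val * x.val)
  left_distrib x y z := congrArg of (add_mul y.val z.val x.val)
  right_distrib x y z := congrArg of (mul_add z.val x.val y.val)
  zero_mul x := congrArg of (mul_zero x.val)
  mul_zero x := congrArg of (zero_mul x.val)
  mul_assoc x y z := congrArg of (mul_assoc z.val y.val x.val).symm

noncomputable instance : Module ℂ (ConjOp D) where
  smul c x := of (star c • x.val)
  one_smul x := congrArg of (by simp)
  mul_smul c d x := congrArg of (by
    change star (c * d) • x.val = star c • star d • x.val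
    rw [star_mul', mul_smul])
  smul_zero c := congrArg of (smul_zero (star c))
  smul_add c x y := congrArg of (smul_add (star c) x.val y.val)
  add_smul c d x := congrArg of (by
    change star (c + d) • x.val = star c • x.val + star d • x.val
    rw [star_add, add_smul])
  zero_smul x := congrArg of (by
    change star (0 : ℂ) • x.val = 0
    rw [star_zero, zero_smul])

instance [SMulCommClass ℂ D D] : IsScalarTower ℂ (ConjOp D) (ConjOp D) where
  smul_assoc c x y := congrArg of (mul_smul_comm (star c) y.val x.val)

instance [IsScalarTower ℂ D D] : SMulCommClass ℂ (ConjOp D) (ConjOp D) where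
  smul_comm c x y := congrArg of (smul_mul_assoc (star c) y.val x.val).symm

end ConjOp

namespace FreeProd

variable {A : Type u} {B : Type v}
  [NonUnitalRing A] [Module ℂ A] [IsScalarTower ℂ A A] [SMulCommClass ℂ A A]
  [StarRing A] [StarModule ℂ A]
  [NonUnitalRing B] [Module ℂ B] [IsScalarTower ℂ B B] [SMulCommClass ℂ B B]
  [StarRing B] [StarModule ℂ B]

/-- For `j : A → D`, the map `a ↦ j (a ^ *)` as a homomorphism to the conjugate opposite algebra. -/
noncomputable def conjHom {A : Type u} {D : Type v}
    [NonUnitalRing A] [Module ℂ A] [StarRing A] [StarModule ℂ A]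
    [NonUnitalRing D] [Module ℂ D] (j : A →ₙₐ[ℂ] D) : A →ₙₐ[ℂ] ConjOp D where
  toFun a := ConjOp.of (j (star a))
  map_smul' c a := congrArg ConjOp.of (by
    change j (star (c • a)) = star c • j (star a)
    rw [star_smul, map_smul])
  map_zero' := congrArg ConjOp.of (by rw [star_zero, map_zero])
  map_add' a a' := congrArg ConjOp.of (by
    change j (star (a + a')) = j (star a) + j (star a')
    rw [star_add, map_add])
  map_mul' a a' := congrArg ConjOp.of (by
    change j (star (a * a')) = j (star a') * j (star a)
    rw [star_mul, map_mul])

/-- The involution of `A ⊔ B`: the antilinear anti-homomorphism which extends the involutions of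
`A` and `B`. -/
noncomputable instance : Star (FreeProd A B) where
  star x := (lift (conjHom (inl : A →ₙₐ[ℂ] FreeProd A B)) (conjHom inr) x).val

theorem star_inl (a : A) : star (inl a : FreeProd A B) = inl (star a) := by
  change (lift (conjHom (inl : A →ₙₐ[ℂ] FreeProd A B)) (conjHom inr) (inl a)).val = _
  rw [lift_inl]; rfl

theorem star_inr (b : B) : star (inr b : FreeProd A B) = inr (star b) := by
  change (lift (conjHom (inl : A →ₙₐ[ℂ] FreeProd A B)) (conjHom inr) (inr b)).val = _
  rw [lift_inr]; rfl

theorem star_add_aux (x y : FreeProd A B) : star (x + y) = star x + star y :=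
  congrArg ConjOp.val (map_add (lift (conjHom (inl : A →ₙₐ[ℂ] FreeProd A B)) (conjHom inr)) x y)

theorem star_mul_aux (x y : FreeProd A B) : star (x * y) = star y * star x :=
  congrArg ConjOp.val (map_mul (lift (conjHom (inl : A →ₙₐ[ℂ] FreeProd A B)) (conjHom inr)) x y)

theorem star_smul_aux (c : ℂ) (x : FreeProd A B) : star (c • x) = star c • star x :=
  congrArg ConjOp.val
    (map_smul (lift (conjHom (inl : A →ₙₐ[ℂ] FreeProd A B)) (conjHom inr)) c x)

noncomputable instance : StarRing (FreeProd A B) where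
  star_involutive x := by
    induction x using FreeProd.induction with
    | hl a => rw [star_inl, star_inl, star_star]
    | hr b => rw [star_inr, star_inr, star_star]
    | add x y hx hy => rw [star_add_aux, star_add_aux, hx, hy]
    | mul x y hx hy => rw [star_mul_aux, star_mul_aux, hx, hy]
    | smul c x hx => rw [star_smul_aux, star_smul_aux, hx, star_star]
  star_add := star_add_aux
  star_mul := star_mul_aux

instance : StarModule ℂ (FreeProd A B) where
  star_smul := star_smul_aux

end FreeProd

/-! ## Products of linear functionals satisfying (A1), (A2), (A3) -/

/-- A `⊙`-independence: it assigns to linear functionals `φ₁`, `φ₂` on algebras `B₁`, `B₂` a linear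
functional `φ₁ ⊙ φ₂` on `B₁ ⊔ B₂` such that the axioms (A1), (A2), (A3) hold. -/
structure OdotIndependence : Type (u + 1) where
  /-- the product `φ₁ ⊙ φ₂` -/
  odot : ∀ {B₁ B₂ : Type u}
    [NonUnitalRing B₁] [Module ℂ B₁] [IsScalarTower ℂ B₁ B₁] [SMulCommClass ℂ B₁ B₁]
    [NonUnitalRing B₂] [Module ℂ B₂] [IsScalarTower ℂ B₂ B₂] [SMulCommClass ℂ B₂ B₂],
    (B₁ →ₗ[ℂ] ℂ) → (B₂ →ₗ[ℂ] ℂ) → (FreeProd B₁ B₂ →ₗ[ℂ] ℂ)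
  /-- (A1) for the first factor -/
  odot_inl : ∀ {B₁ B₂ : Type u}
    [NonUnitalRing B₁] [Module ℂ B₁] [IsScalarTower ℂ B₁ B₁] [SMulCommClass ℂ B₁ B₁]
    [NonUnitalRing B₂] [Module ℂ B₂] [IsScalarTower ℂ B₂ B₂] [SMulCommClass ℂ B₂ B₂]
    (φ₁ : B₁ →ₗ[ℂ] ℂ) (φ₂ : B₂ →ₗ[ℂ] ℂ) (b : B₁), odot φ₁ φ₂ (FreeProd.inl b) = φ₁ b
  /-- (A1) for the second factor -/
  odot_inr : ∀ {B₁ B₂ : Type u}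
    [NonUnitalRing B₁] [Module ℂ B₁] [IsScalarTower ℂ B₁ B₁] [SMulCommClass ℂ B₁ B₁]
    [NonUnitalRing B₂] [Module ℂ B₂] [IsScalarTower ℂ B₂ B₂] [SMulCommClass ℂ B₂ B₂]
    (φ₁ : B₁ →ₗ[ℂ] ℂ) (φ₂ : B₂ →ₗ[ℂ] ℂ) (b : B₂), odot φ₁ φ₂ (FreeProd.inr b) = φ₂ b
  /-- (A2), with `(B₁ ⊔ B₂) ⊔ B₃` and `B₁ ⊔ (B₂ ⊔ B₃)` identified -/
  odot_assoc : ∀ {B₁ B₂ B₃ : Type u}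
    [NonUnitalRing B₁] [Module ℂ B₁] [IsScalarTower ℂ B₁ B₁] [SMulCommClass ℂ B₁ B₁]
    [NonUnitalRing B₂] [Module ℂ B₂] [IsScalarTower ℂ B₂ B₂] [SMulCommClass ℂ B₂ B₂]
    [NonUnitalRing B₃] [Module ℂ B₃] [IsScalarTower ℂ B₃ B₃] [SMulCommClass ℂ B₃ B₃]
    (φ₁ : B₁ →ₗ[ℂ] ℂ) (φ₂ : B₂ →ₗ[ℂ] ℂ) (φ₃ : B₃ →ₗ[ℂ] ℂ)
    (x : FreeProd (FreeProd B₁ B₂) B₃),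
    odot (odot φ₁ φ₂) φ₃ x = odot φ₁ (odot φ₂ φ₃) (FreeProd.assoc B₁ B₂ B₃ x)
  /-- (A3) -/
  odot_comp : ∀ {B₁ B₂ C₁ C₂ : Type u}
    [NonUnitalRing B₁] [Module ℂ B₁] [IsScalarTower ℂ B₁ B₁] [SMulCommClass ℂ B₁ B₁]
    [NonUnitalRing B₂] [Module ℂ B₂] [IsScalarTower ℂ B₂ B₂] [SMulCommClass ℂ B₂ B₂]
    [NonUnitalRing C₁] [Module ℂ C₁] [IsScalarTower ℂ C₁ C₁] [SMulCommClass ℂ C₁ C₁]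
    [NonUnitalRing C₂] [Module ℂ C₂] [IsScalarTower ℂ C₂ C₂] [SMulCommClass ℂ C₂ C₂]
    (φ₁ : B₁ →ₗ[ℂ] ℂ) (φ₂ : B₂ →ₗ[ℂ] ℂ) (j₁ : C₁ →ₙₐ[ℂ] B₁) (j₂ : C₂ →ₙₐ[ℂ] B₂)
    (x : FreeProd C₁ C₂),
    odot (φ₁ ∘ₗ (j₁ : C₁ →ₗ[ℂ] B₁)) (φ₂ ∘ₗ (j₂ : C₂ →ₗ[ℂ] B₂)) x
      = odot φ₁ φ₂ (FreeProd.map j₁ j₂ x)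

/-! ## Dual semigroups -/

/-- The structure of a dual semigroup on a `*`-algebra `B`: a comultiplication `Δ : B → B ⊔ B` which
is a `*`-algebra homomorphism, is coassociative, and has the zero homomorphism as its counit. -/
structure DualSemigroup (B : Type u)
    [NonUnitalRing B] [Module ℂ B] [IsScalarTower ℂ B B] [SMulCommClass ℂ B B]
    [StarRing B] [StarModule ℂ B] where
  /-- the comultiplication -/
  Δ : B →⋆ₙₐ[ℂ] FreeProd B B
  coassoc : ∀ b, FreeProd.assoc B B B (FreeProd.map (Δ : B →ₙₐ[ℂ] FreeProd B B)
      (NonUnitalAlgHom.id ℂ B) (Δ b))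
    = FreeProd.map (NonUnitalAlgHom.id ℂ B) (Δ : B →ₙₐ[ℂ] FreeProd B B) (Δ b)
  counit_left : ∀ b, FreeProd.lift (0 : B →ₙₐ[ℂ] B) (NonUnitalAlgHom.id ℂ B) (Δ b) = b
  counit_right : ∀ b, FreeProd.lift (NonUnitalAlgHom.id ℂ B) (0 : B →ₙₐ[ℂ] B) (Δ b) = b

/-! ## Functionals on the symmetric algebra -/

namespace SymFunctional

variable {V : Type u} {W : Type v} [AddCommGroup V] [Module ℂ V] [AddCommGroup W] [Module ℂ W]

/-- The linear functional `f ⊗ g` on `V ⊗ W`, for linear functionals `f` and `g`. -/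
noncomputable def tensor (f : V →ₗ[ℂ] ℂ) (g : W →ₗ[ℂ] ℂ) : V ⊗[ℂ] W →ₗ[ℂ] ℂ :=
  LinearMap.mul' ℂ ℂ ∘ₗ TensorProduct.map f g

/-- The unital multiplicative functional `S(φ)` on the symmetric algebra `S(V)` which extends the
linear functional `φ` on `V`. -/
noncomputable def S (φ : V →ₗ[ℂ] ℂ) : SymmetricAlgebra ℂ V →ₗ[ℂ] ℂ :=
  (SymmetricAlgebra.lift φ).toLinearMap

theorem differentiable_S (ψ : V →ₗ[ℂ] ℂ) (x : SymmetricAlgebra ℂ V) :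
    Differentiable ℝ (fun t : ℝ => S ((t : ℂ) • ψ) x) := by
  induction x using SymmetricAlgebra.induction with
  | algebraMap r => simp [S]
  | ι v =>
    simp only [S, AlgHom.toLinearMap_apply, SymmetricAlgebra.lift_ι_apply, LinearMap.smul_apply]
    exact (Complex.ofRealCLM.differentiable).smul_const (ψ v)
  | mul a b ha hb =>
    have h := ha.mul hb
    simpa [S, Pi.mul_def] using h
  | add a b ha hb =>
    have h := ha.add hb
    simpa [S, Pi.add_def] using h

/-- The linear functional `D(ψ)` on `S(V)`, `D(ψ)(x) = d/dt S(t ψ)(x)` at `t = 0`. -/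
noncomputable def D (ψ : V →ₗ[ℂ] ℂ) : SymmetricAlgebra ℂ V →ₗ[ℂ] ℂ where
  toFun x := deriv (fun t : ℝ => S ((t : ℂ) • ψ) x) 0
  map_add' x y := by
    simp only [map_add]
    exact deriv_fun_add (differentiable_S ψ x 0) (differentiable_S ψ y 0)
  map_smul' c x := by
    simp only [map_smul, smul_eq_mul, RingHom.id_apply]
    exact deriv_const_mul c (differentiable_S ψ x 0)

/-- The comultiplication `S(δ) : S(V) → S(V) ⊗ S(V)` determined by `δ : V → S(V) ⊗ S(V)`. -/
noncomputable def comul (δ : V →ₗ[ℂ] SymmetricAlgebra ℂ V ⊗[ℂ] SymmetricAlgebra ℂ V) :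
    SymmetricAlgebra ℂ V →ₗ[ℂ] SymmetricAlgebra ℂ V ⊗[ℂ] SymmetricAlgebra ℂ V :=
  (SymmetricAlgebra.lift δ).toLinearMap

/-- The convolution powers, with respect to the comultiplication `S(δ)` and the counit `S(0)`, of a
linear functional on `S(V)`. -/
noncomputable def convPow (δ : V →ₗ[ℂ] SymmetricAlgebra ℂ V ⊗[ℂ] SymmetricAlgebra ℂ V)
    (f : SymmetricAlgebra ℂ V →ₗ[ℂ] ℂ) : ℕ → (SymmetricAlgebra ℂ V →ₗ[ℂ] ℂ)
  | 0 => S 0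
  | n + 1 => tensor (convPow δ f n) f ∘ₗ comul δ

end SymFunctional

/-! ## Convolution on a dual semigroup -/

namespace OdotIndependence

variable (P : OdotIndependence.{u})

section

variable {B₁ B₂ : Type u}
  [NonUnitalRing B₁] [Module ℂ B₁] [IsScalarTower ℂ B₁ B₁] [SMulCommClass ℂ B₁ B₁]
  [NonUnitalRing B₂] [Module ℂ B₂] [IsScalarTower ℂ B₂ B₂] [SMulCommClass ℂ B₂ B₂]

/-- `σ : B₁ ⊔ B₂ → S(B₁) ⊗ S(B₂)` satisfies `φ₁ ⊙ φ₂ = (S(φ₁) ⊗ S(φ₂)) ∘ σ` for all `φ₁`, `φ₂`. -/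
def IsSigma (σ : FreeProd B₁ B₂ →ₗ[ℂ] SymmetricAlgebra ℂ B₁ ⊗[ℂ] SymmetricAlgebra ℂ B₂) : Prop :=
  ∀ (φ₁ : B₁ →ₗ[ℂ] ℂ) (φ₂ : B₂ →ₗ[ℂ] ℂ),
    P.odot φ₁ φ₂ = SymFunctional.tensor (SymFunctional.S φ₁) (SymFunctional.S φ₂) ∘ₗ σ

end

variable {B : Type u}
  [NonUnitalRing B] [Module ℂ B] [IsScalarTower ℂ B B] [SMulCommClass ℂ B B]
  [StarRing B] [StarModule ℂ B] (H : DualSemigroup B)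

/-- The convolution product `φ₁ ⋆ φ₂ = (φ₁ ⊙ φ₂) ∘ Δ`. -/
noncomputable def conv (φ₁ φ₂ : B →ₗ[ℂ] ℂ) : B →ₗ[ℂ] ℂ :=
  P.odot φ₁ φ₂ ∘ₗ ((H.Δ : B →ₙₐ[ℂ] FreeProd B B) : B →ₗ[ℂ] FreeProd B B)

/-- The convolution powers `φ ^ (⋆ n)`; the zero functional is the unit of `⋆`. -/
noncomputable def convPow (φ : B →ₗ[ℂ] ℂ) : ℕ → (B →ₗ[ℂ] ℂ)
  | 0 => 0
  | n + 1 => P.conv H (convPow φ n) φ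

/-- `φ = exp_⋆ ψ`, that is, `φ` is the restriction to `B` of the convolution exponential
`∑ D(ψ) ^ (⋆ n) / n !` on the bialgebra `(S(B), S(σ ∘ Δ))`, the series being point-wise
convergent. -/
def IsConvExp (ψ φ : B →ₗ[ℂ] ℂ) : Prop :=
  ∃ σ : FreeProd B B →ₗ[ℂ] SymmetricAlgebra ℂ B ⊗[ℂ] SymmetricAlgebra ℂ B, P.IsSigma σ ∧
    ∀ b : B, HasSum (fun n : ℕ => SymFunctional.convPow
        (σ ∘ₗ ((H.Δ : B →ₙₐ[ℂ] FreeProd B B) : B →ₗ[ℂ] FreeProd B B))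
        (SymFunctional.D ψ) n (SymmetricAlgebra.ι ℂ B b) / (n.factorial : ℂ)) (φ b)

end OdotIndependence

/-! The limit is an instance of `A(t/n)^n → exp(tL)` for a curve of matrices with `A(0) = 1` and
right derivative `L` at `0`: only the tangent at time `0` matters, and `γ_s ∘ κ` is tangent to `s (ψ
∘ κ)`. What has to be shown is that `σ` exists and that the convolution calculus is locally
finite-dimensional.

Existence of `σ` (`exists_isSigma`): the value of `φ₁ ⊙ φ₂` at a product of letters must be a
polynomial in moments of `φ₁` and `φ₂`. Any word is the image of a word with pairwise different
letters in free algebras, and (A3) transports the value. Substituting the triple of multiples `(p 0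
• x, p 1 • x, p 2 • x)` for a letter `x` is a homomorphism into the cube of the free algebra, so
(A3) makes the value linear in `p`. This linearity alone forces the value to depend only on the
finitely many moments of words without repeated letters, and affinely on each (`LetterLinear.congr`,
`LetterLinear.affine`); such a function is a polynomial. The functionals `S(φ) ⊗ S(ψ)` separate
points (`ext_tensor_S`), which gives linearity and uniqueness of `σ`.

Convolution: the operators `(id ⊗ S(φ)) ∘ Δ_S` turn `⋆` into composition. Applied to a fixed `x`,
they span a finite-dimensional invariant space `translates`, also invariant under the operator `L`
of `D(ψ)`, which is the derivative of these operators along any curve of functionals tangent to `ψ`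
at `0`. Hence the exponential series converges to matrix elements of `exp(tL)`, `γ_0 = 0` and `γ'_0
= ψ` (`IsConvExp.zero_and_hasDerivWithinAt`), and powers along every tangent curve converge to the
exponential (`IsConvExp.tendsto_convPow`). The theorem applies the last fact on `C` to the curve
`γ_s ∘ κ`. -/

/-! ## Functions which are multi-affine in finitely many coordinates -/

section Polynomial

variable {Ω : Type*}

/-- A function of `z : Ω → ℂ` which depends on finitely many coordinates only and is affine in each
of them is a polynomial in the coordinates. -/
theorem mem_adjoin_eval_of_affine (T : Set Ω) (hT : T.Finite) (f : (Ω → ℂ) → ℂ)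
    (hdep : ∀ z z', (∀ w ∈ T, z w = z' w) → f z = f z')
    (haff : ∀ w ∈ T, ∀ z : Ω → ℂ, ∃ a b : ℂ, ∀ (t : ℂ) (z' : Ω → ℂ),
      (∀ v, v ≠ w → z' v = z v) → z' w = t → f z' = a + b * t) :
    f ∈ Algebra.adjoin ℂ (Set.range fun (w : Ω) (z : Ω → ℂ) => z w) := by
  classical
  induction T, hT using Set.Finite.induction_on generalizing f with
  | empty =>
    have : f = algebraMap ℂ ((Ω → ℂ) → ℂ) (f 0) := by
      funext z
      exact hdep z 0 (by simp)
    rw [this]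
    exact Subalgebra.algebraMap_mem _ _
  | @insert w T hw _ ih =>
    have key : ∀ s : ℂ, (fun z => f (Function.update z w s)) ∈
        Algebra.adjoin ℂ (Set.range fun (w : Ω) (z : Ω → ℂ) => z w) := by
      intro s
      refine ih _ (fun z z' h => hdep _ _ ?_) ?_
      · intro v hv
        rcases eq_or_ne v w with rfl | hvw
        · simp
        · simpa [hvw] using h v (hv.resolve_left hvw)
      · intro v hv z
        have hvw : v ≠ w := fun h => hw (h ▸ hv)
        obtain ⟨a, b, hab⟩ := haff v (Or.inr hv) (Function.update z w s)
        refine ⟨a, b, fun t z' hz' ht => hab t _ ?_ (by simpa [hvw] using ht)⟩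
        intro v' hv'
        rcases eq_or_ne v' w with rfl | h
        · simp
        · simpa [h] using hz' v' hv'
    -- An affine function of one coordinate is interpolated from its values at `0` and `1`; both
    -- restrictions depend on the coordinates in `T` only.
    have hf : f = (fun z => f (Function.update z w 0)) +
        (fun z => z w) * ((fun z => f (Function.update z w 1)) -
          fun z => f (Function.update z w 0)) := by
      funext z
      obtain ⟨a, b, hab⟩ := haff w (Or.inl rfl) z
      have hu : ∀ t, f (Function.update z w t) = a + b * t := fun t =>
        hab t _ (fun v hv => by simp [hv]) (by simp)
      simp only [Pi.add_apply, Pi.mul_apply, Pi.sub_apply, hu, hab (z w) z (fun _ _ => rfl) rfl]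
      ring
    rw [hf]
    exact add_mem (key 0) (mul_mem (Algebra.subset_adjoin ⟨w, rfl⟩) (sub_mem (key 1) (key 0)))

/-- The combination `∑ k, p k ^ d • Φ k` of families of moments, where `d` is a degree. -/
noncomputable def gradedSum (d : Ω → ℕ) (Φ : Fin 3 → Ω → ℂ) (p : Fin 3 → ℂ) : Ω → ℂ :=
  fun w => ∑ k, Φ k w * p k ^ d w

/-- A function of families of moments is linear in a letter if it is linear under substitutions
of multiples for that letter. -/
structure LetterLinear (d : Ω → ℕ) (f : (Ω → ℂ) → ℂ) : Prop where
  add : ∀ Φ p q, f (gradedSum d Φ (p + q)) = f (gradedSum d Φ p) + f (gradedSum d Φ q)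
  smul : ∀ Φ (c : ℂ) p, f (gradedSum d Φ (c • p)) = c * f (gradedSum d Φ p)

namespace LetterLinear

variable {d : Ω → ℕ} {f : (Ω → ℂ) → ℂ} (hf : LetterLinear d f)
include hf

/-- Three families suffice: with weights `(1, 0, 1)`, `(0, 1, 1)` and their sum `(1, 1, 2)`, the
third family can absorb any discrepancy between `z` and `z₁ + z₂` in degrees at least two. -/
theorem map_add (z z₁ z₂ : Ω → ℂ) (h0 : ∀ w, d w = 0 → z₁ w = z w ∧ z₂ w = z w)
    (h1 : ∀ w, d w = 1 → z w = z₁ w + z₂ w) : f z = f z₁ + f z₂ := by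
  -- Solves `z₁ + z₂ - 2 e + 2 ^ d e = z`. In degree one the denominator vanishes, so `e = 0`, and
  -- `h1` gives the equation; in degree zero `e = z`.
  let e : Ω → ℂ := fun w => (z w - z₁ w - z₂ w) / (2 ^ d w - 2)
  have h := hf.add ![fun w => z₁ w - e w, fun w => z₂ w - e w, e] ![1, 0, 1] ![0, 1, 1]
  have key : ∀ w, z w = z₁ w + z₂ w - 2 * e w + 2 ^ d w * e w ∧ (d w = 0 → e w = z w) := by
    intro w
    refine ⟨?_, fun hw => ?_⟩
    · by_cases hw : d w = 1
      · simp [e, hw, h1 w hw]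
      · have : (2 : ℂ) ^ d w - 2 ≠ 0 := by
          rw [sub_ne_zero]
          intro h
          have h' : (2 : ℕ) ^ d w = 2 ^ 1 := by exact_mod_cast h
          exact hw (Nat.pow_right_injective le_rfl h')
        have he : e w * (2 ^ d w - 2) = z w - z₁ w - z₂ w := div_mul_cancel₀ _ this
        linear_combination -he
    · obtain ⟨h₁, h₂⟩ := h0 w hw
      simp only [e, hw, h₁, h₂, pow_zero]
      ring
  convert h using 2
  · funext w
    obtain ⟨h2, h3⟩ := key w
    by_cases hw : d w = 0
    · simp [gradedSum, Fin.sum_univ_three, hw, h3 hw, h0 w hw]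
    · simp only [gradedSum, Fin.sum_univ_three]
      simp
      rw [h2, show (1 + 1 : ℂ) = 2 by norm_num]
      ring
  · congr 1
    funext w
    obtain ⟨h2, h3⟩ := key w
    by_cases hw : d w = 0
    · simp [gradedSum, Fin.sum_univ_three, hw, h3 hw, h0 w hw]
    · simp [gradedSum, Fin.sum_univ_three, hw]
  · congr 1
    funext w
    obtain ⟨h2, h3⟩ := key w
    by_cases hw : d w = 0
    · simp [gradedSum, Fin.sum_univ_three, hw, h3 hw, h0 w hw]
    · simp [gradedSum, Fin.sum_univ_three, hw]

theorem map_smul (c : ℂ) (z z₁ : Ω → ℂ) (h0 : ∀ w, d w = 0 → z₁ w = z w)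
    (h1 : ∀ w, d w = 1 → z w = c * z₁ w) : f z = c * f z₁ := by
  have hs : ∀ a : ℂ, f (fun w => a ^ d w * z₁ w) = a * f z₁ := by
    intro a
    have h := hf.smul ![z₁, 0, 0] a 1
    convert h using 2
    · funext w
      simp [gradedSum, Fin.sum_univ_three, mul_comm]
    · congr 1
      funext w
      simp [gradedSum, Fin.sum_univ_three]
  -- The second summand keeps the degree-zero moments and kills the others; `f` vanishes there by
  -- homogeneity with factor `0`.
  have h := hf.map_add z (fun w => c ^ d w * z₁ w) (fun w => 0 ^ d w * z₁ w)
    (fun w hw => by simp [hw, h0 w hw]) (fun w hw => by simp [hw, h1 w hw])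
  rw [h, hs, hs]
  ring

/-- The case `c = 1` of `map_smul`, whose hypotheses see no moment of degree above one. -/
theorem congr {z z' : Ω → ℂ} (h : ∀ w, d w ≤ 1 → z w = z' w) : f z = f z' := by
  have := hf.map_smul 1 z z' (fun w hw => (h w (by omega)).symm)
    (fun w hw => by rw [one_mul]; exact h w (by omega))
  rwa [one_mul] at this

/-- Additivity splits off the coordinate `w`, with the degree-zero moments kept in both summands;
the split-off part is homogeneous in `t`. -/
theorem affine {w : Ω} (hw : d w = 1) (z : Ω → ℂ) : ∃ a b : ℂ, ∀ (t : ℂ) (z' : Ω → ℂ),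
    (∀ v, v ≠ w → z' v = z v) → z' w = t → f z' = a + b * t := by
  classical
  refine ⟨f (Function.update z w 0),
    f (fun v => if d v = 0 then z v else if v = w then 1 else 0), fun t z' h ht => ?_⟩
  have hne : ∀ v, d v = 0 → v ≠ w := by
    rintro v hv rfl
    omega
  rw [hf.map_add z' (Function.update z w 0)
    (fun v => if d v = 0 then z v else if v = w then t else 0), mul_comm _ t]
  · congr 1
    refine hf.map_smul t _ _ (fun v hv => by simp [hv]) (fun v hv => by simp [hv])
  · intro v hv
    simp [hv, hne v hv, h v (hne v hv)]
  · intro v hv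
    rcases eq_or_ne v w with rfl | hvw
    · simp [hw, ht]
    · simp [hv, hvw, h v hvw]

end LetterLinear

/-- A function of families of moments which is linear in each of finitely many letters is a
polynomial in the moments. -/
theorem mem_adjoin_eval_of_letterLinear {I : Type*} [Finite I] (d : I → Ω → ℕ)
    (hd : ∀ w, ∃ i, d i w ≠ 0) (hfin : {w | ∀ i, d i w ≤ 1}.Finite) (f : (Ω → ℂ) → ℂ)
    (hf : ∀ i, LetterLinear (d i) f) :
    f ∈ Algebra.adjoin ℂ (Set.range fun (w : Ω) (z : Ω → ℂ) => z w) := by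
  classical
  refine mem_adjoin_eval_of_affine _ hfin f ?_ ?_
  · have : Fintype I := Fintype.ofFinite I
    have key : ∀ (s : Finset I) (z z' : Ω → ℂ), (∀ w, (∀ i ∈ s, d i w ≤ 1) → z w = z' w) →
        f z = f z' := by
      intro s
      induction s using Finset.induction_on with
      | empty =>
        intro z z' h
        congr 1
        funext w
        exact h w (by simp)
      | insert i s _ ih =>
        intro z z' h
        -- Changing the moments of degree above one in the letter `i` does not affect `f`; this
        -- removes one letter at a time.
        let z'' : Ω → ℂ := fun w => if d i w ≤ 1 then z w else z' w
        have h1 : f z = f z'' := (hf i).congr fun w hw => by simp [z'', hw]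
        rw [h1]
        refine ih _ _ fun w hw => ?_
        by_cases hi : d i w ≤ 1
        · simp only [z'', hi, if_true]
          refine h w fun j hj => ?_
          rcases Finset.mem_insert.1 hj with rfl | hj
          · exact hi
          · exact hw j hj
        · simp [z'', hi]
    intro z z' h
    exact key Finset.univ z z' fun w hw => h w fun i => hw i (Finset.mem_univ i)
  · intro w hw z
    obtain ⟨i, hi⟩ := hd w
    exact (hf i).affine (le_antisymm (hw i) (Nat.one_le_iff_ne_zero.2 hi)) z

end Polynomial

/-! ## Words -/

namespace FreeSemigroup

open scoped Classical in
/-- The number of occurrences of a letter in a word. -/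
noncomputable def occ {X : Type*} (i : X) (w : FreeSemigroup X) : ℕ := (w.head :: w.tail).count i

section

variable {X : Type*} (i : X)

open scoped Classical in
theorem occ_of (x : X) : occ i (of x) = if x = i then 1 else 0 := by
  simp [occ, of, List.count_singleton]

theorem occ_mul (w w' : FreeSemigroup X) : occ i (w * w') = occ i w + occ i w' := by
  classical
  simp only [occ, head_mul, tail_mul]
  rw [← List.count_append]
  rfl

theorem occ_map {Y : Type*} {g : X → Y} (hg : Function.Injective g) (w : FreeSemigroup X) :
    occ (g i) (map g w) = occ i w := by
  induction w using FreeSemigroup.recOnMul with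
  | ih1 x =>
    rw [map_of, occ_of, occ_of]
    rcases eq_or_ne x i with rfl | hx
    · rw [if_pos rfl, if_pos rfl]
    · rw [if_neg hx, if_neg (hg.ne hx)]
  | ih2 x y hx hy => rw [map_mul, occ_mul, occ_mul, hx, hy]

theorem occ_map_eq_zero {Y : Type*} {g : X → Y} {j : Y} (hj : ∀ x, g x ≠ j)
    (w : FreeSemigroup X) : occ j (map g w) = 0 := by
  induction w using FreeSemigroup.recOnMul with
  | ih1 x => simp [occ_of, hj]
  | ih2 x y hx hy => rw [map_mul, occ_mul, hx, hy]

theorem exists_occ_ne_zero (w : FreeSemigroup X) : ∃ i, occ i w ≠ 0 :=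
  ⟨w.head, by simp [occ]⟩

/-- These words are lists without repetition over a finite alphabet. -/
theorem finite_occ_le_one [Finite X] : {w : FreeSemigroup X | ∀ i, occ i w ≤ 1}.Finite := by
  classical
  have : Fintype X := Fintype.ofFinite X
  have h : {l : List X | l.Nodup}.Finite :=
    @Set.toFinite _ {l : List X | l.Nodup} (@Finite.of_fintype _ fintypeNodupList)
  refine h.preimage (f := fun w : FreeSemigroup X => w.head :: w.tail) ?_ |>.subset ?_
  · rintro ⟨a, l⟩ _ ⟨b, m⟩ _ h
    simpa using h
  · intro w hw
    refine List.nodup_iff_count_le_one.2 fun i => ?_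
    convert hw i using 1
    simp only [occ]

/-- Every word is obtained from a word with pairwise different letters. -/
theorem exists_map_eq {Z : Type u} (w : FreeSemigroup Z) :
    ∃ (X : Type u) (_ : Finite X) (w₀ : FreeSemigroup X) (g : X → Z),
      map g w₀ = w ∧ ∀ i, occ i w₀ = 1 := by
  induction w using FreeSemigroup.recOnMul with
  | ih1 x =>
    exact ⟨PUnit, inferInstance, of PUnit.unit, fun _ => x, rfl, fun i => by simp [occ_of]⟩
  | ih2 x y hx hy =>
    obtain ⟨X, _, w₀, g, hg, h⟩ := hx
    obtain ⟨Y, _, v₀, k, hk, h'⟩ := hy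
    refine ⟨X ⊕ Y, inferInstance, map Sum.inl w₀ * map Sum.inr v₀, Sum.elim g k, ?_, ?_⟩
    · have h1 : (map (Sum.elim g k)).comp (map Sum.inl) = map g := hom_ext rfl
      have h2 : (map (Sum.elim g k)).comp (map Sum.inr) = map k := hom_ext rfl
      rw [map_mul, ← hg, ← hk, ← h1, ← h2]
      rfl
    · rintro (i | i)
      · rw [occ_mul, occ_map _ Sum.inl_injective, occ_map_eq_zero (by simp), h]
      · rw [occ_mul, occ_map _ Sum.inr_injective, occ_map_eq_zero (by simp), h']

end

section Lift

variable {X : Type*} {R : Type*} {i : X} {f g h : X → R}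

theorem lift_congr [Semigroup R] (hfg : ∀ x, x ≠ i → f x = g x) {w : FreeSemigroup X}
    (hw : occ i w = 0) : lift f w = lift g w := by
  induction w using FreeSemigroup.recOnMul with
  | ih1 x =>
    refine hfg x fun hx => ?_
    simp [occ_of, hx] at hw
  | ih2 x y hx hy =>
    rw [occ_mul, Nat.add_eq_zero_iff] at hw
    rw [map_mul, map_mul, hx hw.1, hy hw.2]

theorem lift_add [NonUnitalSemiring R] (hf : ∀ x, x ≠ i → h x = f x)
    (hg : ∀ x, x ≠ i → h x = g x) (hi : h i = f i + g i) {w : FreeSemigroup X}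
    (hw : occ i w = 1) : lift h w = lift f w + lift g w := by
  have hfg : ∀ x, x ≠ i → f x = g x := fun x hx => (hf x hx).symm.trans (hg x hx)
  induction w using FreeSemigroup.recOnMul with
  | ih1 x =>
    obtain rfl : x = i := by
      by_contra hx
      simp [occ_of, hx] at hw
    exact hi
  | ih2 x y hx hy =>
    rw [occ_mul] at hw
    simp only [map_mul]
    rcases Nat.eq_zero_or_pos (occ i (of x)) with h0 | h0
    · rw [hy (by omega), mul_add, ← lift_congr hf h0, ← lift_congr hg h0]
    · rw [hx (by omega), add_mul, ← lift_congr hf (w := y) (by omega),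
        ← lift_congr hg (w := y) (by omega)]

theorem lift_smul [NonUnitalSemiring R] [Module ℂ R] [IsScalarTower ℂ R R] [SMulCommClass ℂ R R]
    (hf : ∀ x, x ≠ i → h x = f x) (c : ℂ) (hi : h i = c • f i) (w : FreeSemigroup X) :
    lift h w = c ^ occ i w • lift f w := by
  induction w using FreeSemigroup.recOnMul with
  | ih1 x =>
    rcases eq_or_ne x i with rfl | hx
    · simp [occ_of, hi]
    · simp [occ_of, hx, hf x hx]
  | ih2 x y hx hy =>
    rw [map_mul, map_mul, hx, hy, occ_mul, pow_add, smul_mul_smul_comm]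

end Lift

end FreeSemigroup

/-! ## Separation of points by the functionals `S(φ)` -/

namespace SymFunctional

variable {V : Type u} {W : Type v} [AddCommGroup V] [Module ℂ V] [AddCommGroup W] [Module ℂ W]

theorem S_ι (φ : V →ₗ[ℂ] ℂ) (v : V) : S φ (SymmetricAlgebra.ι ℂ V v) = φ v := by
  simp [S]

theorem S_mul (φ : V →ₗ[ℂ] ℂ) (x y : SymmetricAlgebra ℂ V) : S φ (x * y) = S φ x * S φ y := by
  simp [S]

/-- In a basis of `V` the symmetric algebra is a polynomial ring and the `S φ` are its point
evaluations; a polynomial over `ℂ` that vanishes at all points is zero. -/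
theorem eq_zero_of_S_eq_zero {x : SymmetricAlgebra ℂ V} (h : ∀ φ, S φ x = 0) : x = 0 := by
  let b := Module.Basis.ofVectorSpace ℂ V
  let e := SymmetricAlgebra.equivMvPolynomial b
  apply e.injective
  rw [map_zero]
  refine MvPolynomial.funext fun a => ?_
  rw [map_zero]
  have : (MvPolynomial.aeval a).comp (e : SymmetricAlgebra ℂ V →ₐ[ℂ] _)
      = SymmetricAlgebra.lift (b.constr ℂ a) := by
    refine SymmetricAlgebra.algHom_ext (b.ext fun i => ?_)
    simp [e]
  rw [← MvPolynomial.coe_aeval_eq_eval]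
  exact (DFunLike.congr_fun this x).trans (h _)

theorem ext_S {x y : SymmetricAlgebra ℂ V} (h : ∀ φ, S φ x = S φ y) : x = y :=
  sub_eq_zero.1 <| eq_zero_of_S_eq_zero fun φ => by rw [map_sub, h, sub_self]

@[simp]
theorem tensor_tmul (f : V →ₗ[ℂ] ℂ) (g : W →ₗ[ℂ] ℂ) (v : V) (w : W) :
    tensor f g (v ⊗ₜ w) = f v * g w := by
  simp [tensor]

/-- Separation in two stages: contracting the first factor by `S φ` leaves an element of the second
factor killed by every `S ψ`, hence zero; so the coefficients with respect to a basis of the second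
factor are killed by every `S φ`. -/
theorem ext_tensor_S {x y : SymmetricAlgebra ℂ V ⊗[ℂ] SymmetricAlgebra ℂ W}
    (h : ∀ φ ψ, tensor (S φ) (S ψ) x = tensor (S φ) (S ψ) y) : x = y := by
  classical
  rw [← sub_eq_zero]
  have h' : ∀ φ ψ, tensor (S φ) (S ψ) (x - y) = 0 := fun φ ψ => by rw [map_sub, h, sub_self]
  generalize x - y = z at h'
  let b := Module.Basis.ofVectorSpace ℂ (SymmetricAlgebra ℂ W)
  let e := TensorProduct.equivFinsuppOfBasisRight (M := SymmetricAlgebra ℂ V) b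
  apply e.injective
  rw [map_zero]
  ext i
  refine eq_zero_of_S_eq_zero fun φ => ?_
  have h1 : ((TensorProduct.lid ℂ _).toLinearMap ∘ₗ TensorProduct.map (S φ) LinearMap.id :
      SymmetricAlgebra ℂ V ⊗[ℂ] SymmetricAlgebra ℂ W →ₗ[ℂ] SymmetricAlgebra ℂ W) z = 0 := by
    refine eq_zero_of_S_eq_zero fun ψ => ?_
    rw [← h' φ ψ, ← LinearMap.comp_apply]
    congr 1
    ext v w
    simp
  have h2 : S φ ∘ₗ (Finsupp.lapply i) ∘ₗ (e : _ →ₗ[ℂ] _)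
      = (Finsupp.lapply i ∘ₗ (b.repr : _ →ₗ[ℂ] _)) ∘ₗ
        ((TensorProduct.lid ℂ _).toLinearMap ∘ₗ TensorProduct.map (S φ) LinearMap.id :
      SymmetricAlgebra ℂ V ⊗[ℂ] SymmetricAlgebra ℂ W →ₗ[ℂ] SymmetricAlgebra ℂ W) := by
    ext v w
    simp [e, mul_comm]
  have h3 := DFunLike.congr_fun h2 z
  rw [LinearMap.comp_apply (Finsupp.lapply i ∘ₗ _) _ z, h1, map_zero] at h3
  exact h3

/-- The functional `S(φ) ⊗ S(ψ)` as a homomorphism of algebras. -/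
noncomputable def tensorAlgHom (φ : V →ₗ[ℂ] ℂ) (ψ : W →ₗ[ℂ] ℂ) :
    SymmetricAlgebra ℂ V ⊗[ℂ] SymmetricAlgebra ℂ W →ₐ[ℂ] ℂ :=
  (Algebra.TensorProduct.lmul' ℂ).comp
    (Algebra.TensorProduct.map (SymmetricAlgebra.lift φ) (SymmetricAlgebra.lift ψ))

theorem tensorAlgHom_apply (φ : V →ₗ[ℂ] ℂ) (ψ : W →ₗ[ℂ] ℂ)
    (x : SymmetricAlgebra ℂ V ⊗[ℂ] SymmetricAlgebra ℂ W) :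
    tensorAlgHom φ ψ x = tensor (S φ) (S ψ) x := by
  induction x with
  | zero => simp
  | add x y hx hy => rw [map_add, map_add, hx, hy]
  | tmul x y => simp [tensorAlgHom, S]

end SymFunctional

/-! ## The existence of `σ` -/

theorem FreeSemigroup.map_lift {X A B : Type*}
    [NonUnitalRing A] [Module ℂ A] [NonUnitalRing B] [Module ℂ B]
    (F : A →ₙₐ[ℂ] B) (f : X → A) (w : FreeSemigroup X) :
    F (FreeSemigroup.lift f w) = FreeSemigroup.lift (fun x => F (f x)) w := by
  induction w using FreeSemigroup.recOnMul with
  | ih1 x => rfl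
  | ih2 x y hx hy => rw [map_mul, map_mul, map_mul, hx, hy]

/-- The free non-unital algebra. -/
abbrev FreeNonUnital (X : Type u) : Type u := MonoidAlgebra ℂ (FreeSemigroup X)

namespace FreeNonUnital

variable {X : Type u}

/-- The functional with given values at the words. -/
noncomputable def functional (z : FreeSemigroup X → ℂ) : FreeNonUnital X →ₗ[ℂ] ℂ :=
  (MonoidAlgebra.basis (FreeSemigroup X) ℂ).constr ℂ z

/-- The word as an element of the free algebra. -/
noncomputable def word (w : FreeSemigroup X) : FreeNonUnital X := MonoidAlgebra.single w 1

theorem functional_word (z : FreeSemigroup X → ℂ) (w : FreeSemigroup X) :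
    functional z (word w) = z w := by
  rw [functional, word, ← MonoidAlgebra.basis_apply, Module.Basis.constr_basis]

theorem eq_functional {z : FreeSemigroup X → ℂ} {φ : FreeNonUnital X →ₗ[ℂ] ℂ}
    (h : ∀ w, φ (word w) = z w) : φ = functional z :=
  (MonoidAlgebra.basis (FreeSemigroup X) ℂ).ext fun w => by
    rw [MonoidAlgebra.basis_apply]
    exact (h w).trans (functional_word z w).symm

theorem functional_moments (φ : FreeNonUnital X →ₗ[ℂ] ℂ) :
    functional (fun w => φ (word w)) = φ :=
  (eq_functional fun _ => rfl).symm

variable {R : Type v} [NonUnitalRing R] [Module ℂ R] [IsScalarTower ℂ R R] [SMulCommClass ℂ R R]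

/-- The homomorphism with given values at the letters. -/
noncomputable def lift (f : X → R) : FreeNonUnital X →ₙₐ[ℂ] R :=
  MonoidAlgebra.liftMagma ℂ (FreeSemigroup.lift f)

theorem lift_word (f : X → R) (w : FreeSemigroup X) : lift f (word w) = FreeSemigroup.lift f w := by
  simp [lift, word]

/-- The letter as an element of the free algebra. -/
noncomputable def letter (x : X) : FreeNonUnital X := word (FreeSemigroup.of x)

theorem lift_letter (f : X → R) (x : X) : lift f (letter x) = f x := by
  rw [letter, lift_word, FreeSemigroup.lift_of]

theorem lift_letter_eq_word (w : FreeSemigroup X) :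
    FreeSemigroup.lift (letter : X → FreeNonUnital X) w = word w := by
  induction w using FreeSemigroup.recOnMul with
  | ih1 x => rfl
  | ih2 x y hx hy =>
    rw [map_mul, hx, hy, word, word, word, MonoidAlgebra.single_mul_single, one_mul]

open scoped Classical in
/-- The substitution of `(p k • x_i)_k` for the letter `x_i`. -/
noncomputable def subst (i : X) (p : Fin 3 → ℂ) : FreeNonUnital X →ₙₐ[ℂ] (Fin 3 → FreeNonUnital X) :=
  lift fun x k => if x = i then p k • letter x else letter x

theorem subst_letter_self (i : X) (p : Fin 3 → ℂ) :
    subst i p (letter i) = fun k => p k • letter i := by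
  simp [subst, lift_letter]

theorem subst_letter_of_ne {i x : X} (h : x ≠ i) (p : Fin 3 → ℂ) :
    subst i p (letter x) = fun _ => letter x := by
  simp [subst, lift_letter, h]

theorem subst_word (i : X) (p : Fin 3 → ℂ) (w : FreeSemigroup X) (k : Fin 3) :
    subst i p (word w) k = p k ^ w.occ i • word w := by
  have h : subst i p (word w) k = FreeSemigroup.lift
      (fun x => subst i p (letter x) k) w := by
    induction w using FreeSemigroup.recOnMul with
    | ih1 x => rfl
    | ih2 x y hx hy =>
      rw [map_mul, ← hx, ← hy, ← Pi.mul_apply, ← map_mul]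
      simp only [← lift_letter_eq_word, map_mul]
  rw [h, ← lift_letter_eq_word]
  refine FreeSemigroup.lift_smul (i := i) (fun x hx => ?_) _ ?_ _
  · rw [subst_letter_of_ne hx]
  · rw [subst_letter_self]

/-- The functional on `F ^ 3` with given values at the words. -/
noncomputable def functional₃ (Φ : Fin 3 → FreeSemigroup X → ℂ) :
    (Fin 3 → FreeNonUnital X) →ₗ[ℂ] ℂ :=
  ∑ k, functional (Φ k) ∘ₗ LinearMap.proj k

/-- This is where `gradedSum` comes from: a word with `d` occurrences of the letter `i` acquires the
factor `p k ^ d` in the `k`-th component. -/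
theorem functional₃_comp_subst (Φ : Fin 3 → FreeSemigroup X → ℂ) (i : X) (p : Fin 3 → ℂ) :
    functional₃ Φ ∘ₗ (subst i p : FreeNonUnital X →ₗ[ℂ] _)
      = functional (gradedSum (FreeSemigroup.occ i) Φ p) := by
  refine eq_functional fun w => ?_
  simp only [functional₃, gradedSum, LinearMap.comp_apply, LinearMap.sum_apply, LinearMap.proj_apply]
  refine Finset.sum_congr rfl fun k _ => ?_
  change functional (Φ k) (subst i p (word w) k) = _
  rw [subst_word, map_smul, functional_word, smul_eq_mul, mul_comm]

end FreeNonUnital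

namespace FreeProd

variable {A : Type u} {B : Type v} {A' B' : Type*}
  [NonUnitalRing A] [Module ℂ A] [IsScalarTower ℂ A A] [SMulCommClass ℂ A A]
  [NonUnitalRing B] [Module ℂ B] [IsScalarTower ℂ B B] [SMulCommClass ℂ B B]
  [NonUnitalRing A'] [Module ℂ A'] [IsScalarTower ℂ A' A'] [SMulCommClass ℂ A' A']
  [NonUnitalRing B'] [Module ℂ B'] [IsScalarTower ℂ B' B'] [SMulCommClass ℂ B' B']

@[simp]
theorem map_inl (f : A →ₙₐ[ℂ] A') (g : B →ₙₐ[ℂ] B') (a : A) :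
    map f g (inl a) = inl (f a) := by
  simp [map]

@[simp]
theorem map_inr (f : A →ₙₐ[ℂ] A') (g : B →ₙₐ[ℂ] B') (b : B) :
    map f g (inr b) = inr (g b) := by
  simp [map]

/-- The element of the free product which corresponds to a word in the elements of the factors. -/
noncomputable def ofWord : FreeSemigroup (A ⊕ B) →ₙ* FreeProd A B :=
  FreeSemigroup.lift (Sum.elim inl inr)

theorem mem_span_range_ofWord (x : FreeProd A B) :
    x ∈ Submodule.span ℂ (Set.range (ofWord : FreeSemigroup (A ⊕ B) → FreeProd A B)) := by
  induction x using FreeProd.induction with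
  | hl a => exact Submodule.subset_span ⟨FreeSemigroup.of (Sum.inl a), rfl⟩
  | hr b => exact Submodule.subset_span ⟨FreeSemigroup.of (Sum.inr b), rfl⟩
  | add x y hx hy => exact add_mem hx hy
  | smul c x hx => exact Submodule.smul_mem _ c hx
  | mul x y hx hy =>
    induction hx using Submodule.span_induction with
    | zero => rw [zero_mul]; exact zero_mem _
    | add x x' _ _ hx hx' => rw [add_mul]; exact add_mem hx hx'
    | smul c x _ hx => rw [smul_mul_assoc]; exact Submodule.smul_mem _ c hx
    | mem x hx =>
      obtain ⟨v, rfl⟩ := hx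
      induction hy using Submodule.span_induction with
      | zero => rw [mul_zero]; exact zero_mem _
      | add x x' _ _ hx hx' => rw [mul_add]; exact add_mem hx hx'
      | smul c x _ hx => rw [mul_smul_comm]; exact Submodule.smul_mem _ c hx
      | mem y hy =>
        obtain ⟨w, rfl⟩ := hy
        exact Submodule.subset_span ⟨v * w, map_mul _ _ _⟩

end FreeProd

namespace OdotIndependence

variable (P : OdotIndependence.{u})

/-! ### Values of the product at words in free generators -/

section GenericWord

variable {X : Type u}

/-- The letter `x` of the first or of the second free algebra. -/
noncomputable def genericLetter (e : X → Bool) (x : X) :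
    FreeProd (FreeNonUnital X) (FreeNonUnital X) :=
  if e x then FreeProd.inl (FreeNonUnital.letter x) else FreeProd.inr (FreeNonUnital.letter x)

/-- The value of the product at a generic word, as a function of the moments of the two
functionals. -/
noncomputable def genericMoment (e : X → Bool) (w : FreeSemigroup X)
    (z : FreeSemigroup X ⊕ FreeSemigroup X → ℂ) : ℂ :=
  P.odot (FreeNonUnital.functional fun v => z (Sum.inl v))
    (FreeNonUnital.functional fun v => z (Sum.inr v)) (FreeSemigroup.lift (genericLetter e) w)

/-- The moments of two functionals. -/
noncomputable def moments (φ₁ φ₂ : FreeNonUnital X →ₗ[ℂ] ℂ) :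
    FreeSemigroup X ⊕ FreeSemigroup X → ℂ :=
  Sum.elim (fun v => φ₁ (FreeNonUnital.word v)) (fun v => φ₂ (FreeNonUnital.word v))

theorem genericMoment_moments (e : X → Bool) (w : FreeSemigroup X)
    (φ₁ φ₂ : FreeNonUnital X →ₗ[ℂ] ℂ) :
    P.genericMoment e w (moments φ₁ φ₂) =
      P.odot φ₁ φ₂ (FreeSemigroup.lift (genericLetter e) w) := by
  simp only [genericMoment, moments, Sum.elim_inl, Sum.elim_inr, FreeNonUnital.functional_moments]

/-- The degree in a letter. -/
noncomputable def letterDegree (i : X) : FreeSemigroup X ⊕ FreeSemigroup X → ℕ :=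
  Sum.elim (FreeSemigroup.occ i) (FreeSemigroup.occ i)

/-- By (A3) the parameter `p` moves from the functionals into the argument, where it enters through
the substituted letter only. -/
theorem genericMoment_gradedSum (e : X → Bool) (w : FreeSemigroup X) (i : X)
    (Φ : Fin 3 → FreeSemigroup X ⊕ FreeSemigroup X → ℂ) (p : Fin 3 → ℂ) :
    P.genericMoment e w (gradedSum (letterDegree i) Φ p) =
      P.odot (FreeNonUnital.functional₃ fun k v => Φ k (Sum.inl v))
        (FreeNonUnital.functional₃ fun k v => Φ k (Sum.inr v))
        (FreeSemigroup.lift (fun x => FreeProd.map (FreeNonUnital.subst i p)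
          (FreeNonUnital.subst i p) (genericLetter e x)) w) := by
  rw [← FreeSemigroup.map_lift, ← P.odot_comp, FreeNonUnital.functional₃_comp_subst,
    FreeNonUnital.functional₃_comp_subst]
  rfl

/-- The image of the letter `i` in the cube is linear in `p`, the other letters have images
independent of `p`, and `i` occurs exactly once. -/
theorem letterLinear_genericMoment (e : X → Bool) {w : FreeSemigroup X} {i : X}
    (hw : w.occ i = 1) : LetterLinear (letterDegree i) (P.genericMoment e w) := by
  have hne : ∀ (p q : Fin 3 → ℂ) (x : X), x ≠ i →
      FreeProd.map (FreeNonUnital.subst i p) (FreeNonUnital.subst i p) (genericLetter e x) =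
      FreeProd.map (FreeNonUnital.subst i q) (FreeNonUnital.subst i q) (genericLetter e x) := by
    intro p q x hx
    unfold genericLetter
    split_ifs <;> simp [FreeNonUnital.subst_letter_of_ne hx]
  have heq : ∀ (p : Fin 3 → ℂ),
      FreeProd.map (FreeNonUnital.subst i p) (FreeNonUnital.subst i p) (genericLetter e i) =
      if e i then FreeProd.inl (fun k => p k • FreeNonUnital.letter i)
      else FreeProd.inr (fun k => p k • FreeNonUnital.letter i) := by
    intro p
    unfold genericLetter
    split_ifs <;> simp [FreeNonUnital.subst_letter_self]
  constructor
  · intro Φ p q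
    simp only [genericMoment_gradedSum]
    rw [FreeSemigroup.lift_add (hne _ p) (hne _ q) _ hw, map_add]
    rw [heq, heq, heq]
    split_ifs <;> rw [← map_add] <;> congr 1 <;> funext k <;> simp [add_smul]
  · intro Φ c p
    simp only [genericMoment_gradedSum]
    rw [FreeSemigroup.lift_smul (hne _ p) c _ w, hw, pow_one, map_smul, smul_eq_mul]
    rw [heq, heq]
    split_ifs <;> rw [← map_smul] <;> congr 1 <;> funext k <;> simp [mul_smul]

theorem genericMoment_mem_adjoin [Finite X] (e : X → Bool) {w : FreeSemigroup X}
    (hw : ∀ i, w.occ i = 1) : P.genericMoment e w ∈ Algebra.adjoin ℂ (Set.range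
      fun (v : FreeSemigroup X ⊕ FreeSemigroup X)
        (z : FreeSemigroup X ⊕ FreeSemigroup X → ℂ) => z v) := by
  refine mem_adjoin_eval_of_letterLinear letterDegree ?_ ?_ _
    fun i => P.letterLinear_genericMoment e (hw i)
  · rintro (v | v) <;> exact v.exists_occ_ne_zero
  · refine (((FreeSemigroup.finite_occ_le_one (X := X)).image Sum.inl).union
      ((FreeSemigroup.finite_occ_le_one (X := X)).image Sum.inr)).subset ?_
    rintro (v | v) hv
    · exact Or.inl ⟨v, hv, rfl⟩
    · exact Or.inr ⟨v, hv, rfl⟩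

end GenericWord

/-! ### Existence and uniqueness of `σ` -/

section Sigma

variable {B₁ B₂ : Type u}
  [NonUnitalRing B₁] [Module ℂ B₁] [IsScalarTower ℂ B₁ B₁] [SMulCommClass ℂ B₁ B₁]
  [NonUnitalRing B₂] [Module ℂ B₂] [IsScalarTower ℂ B₂ B₂] [SMulCommClass ℂ B₂ B₂]

theorem exists_tensor_eq_odot_ofWord (w : FreeSemigroup (B₁ ⊕ B₂)) :
    ∃ τ : SymmetricAlgebra ℂ B₁ ⊗[ℂ] SymmetricAlgebra ℂ B₂, ∀ φ₁ φ₂,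
      SymFunctional.tensor (SymFunctional.S φ₁) (SymFunctional.S φ₂) τ =
        P.odot φ₁ φ₂ (FreeProd.ofWord w) := by
  obtain ⟨X, _, w₀, g, rfl, hw₀⟩ := w.exists_map_eq
  let e : X → Bool := fun x => (g x).isLeft
  -- A letter belonging to the other factor may go to `0`: the generic word uses each letter on one
  -- side only, as recorded by `e`.
  let j₁ : FreeNonUnital X →ₙₐ[ℂ] B₁ := FreeNonUnital.lift fun x => Sum.elim id 0 (g x)
  let j₂ : FreeNonUnital X →ₙₐ[ℂ] B₂ := FreeNonUnital.lift fun x => Sum.elim 0 id (g x)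
  let Z : (B₁ →ₗ[ℂ] ℂ) → (B₂ →ₗ[ℂ] ℂ) → FreeSemigroup X ⊕ FreeSemigroup X → ℂ := fun φ₁ φ₂ =>
    moments (φ₁ ∘ₗ (j₁ : FreeNonUnital X →ₗ[ℂ] B₁)) (φ₂ ∘ₗ (j₂ : FreeNonUnital X →ₗ[ℂ] B₂))
  have key : ∀ φ₁ φ₂, P.odot φ₁ φ₂ (FreeProd.ofWord (FreeSemigroup.map g w₀)) =
      P.genericMoment e w₀ (Z φ₁ φ₂) := by
    intro φ₁ φ₂
    rw [P.genericMoment_moments, P.odot_comp, FreeSemigroup.map_lift]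
    congr 1
    have h3 : (FreeProd.ofWord (A := B₁) (B := B₂)).comp (FreeSemigroup.map g) =
        FreeSemigroup.lift fun x => FreeProd.map j₁ j₂ (genericLetter e x) := by
      refine FreeSemigroup.hom_ext (funext fun x => ?_)
      change FreeProd.ofWord (FreeSemigroup.of (g x)) = FreeProd.map j₁ j₂ (genericLetter e x)
      rcases hx : g x with a | b <;>
        simp [FreeProd.ofWord, genericLetter, e, hx, j₁, j₂, FreeNonUnital.lift_letter]
    exact DFunLike.congr_fun h3 w₀
  simp only [key]
  have hmem := P.genericMoment_mem_adjoin e hw₀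
  generalize P.genericMoment e w₀ = f at hmem
  simp only [← SymFunctional.tensorAlgHom_apply]
  -- Each moment variable is replaced by `ι (j₁ v) ⊗ 1` or `1 ⊗ ι (j₂ v)`; sums and products carry
  -- over because `S φ₁ ⊗ S φ₂` is multiplicative.
  induction hmem using Algebra.adjoin_induction with
  | mem f hf =>
    obtain ⟨v | v, rfl⟩ := hf
    · refine ⟨SymmetricAlgebra.ι ℂ B₁ (j₁ (FreeNonUnital.word v)) ⊗ₜ 1, fun φ₁ φ₂ => ?_⟩
      simp [SymFunctional.tensorAlgHom, Z, moments]
    · refine ⟨1 ⊗ₜ SymmetricAlgebra.ι ℂ B₂ (j₂ (FreeNonUnital.word v)), fun φ₁ φ₂ => ?_⟩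
      simp [SymFunctional.tensorAlgHom, Z, moments]
  | algebraMap c => exact ⟨algebraMap ℂ _ c, fun φ₁ φ₂ => by rw [AlgHom.commutes]; rfl⟩
  | add f g _ _ hf hg =>
    obtain ⟨τ, hτ⟩ := hf
    obtain ⟨τ', hτ'⟩ := hg
    exact ⟨τ + τ', fun φ₁ φ₂ => by rw [map_add, hτ, hτ']; rfl⟩
  | mul f g _ _ hf hg =>
    obtain ⟨τ, hτ⟩ := hf
    obtain ⟨τ', hτ'⟩ := hg
    exact ⟨τ * τ', fun φ₁ φ₂ => by rw [map_mul, hτ, hτ']; rfl⟩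

theorem exists_tensor_eq_odot (x : FreeProd B₁ B₂) :
    ∃ τ : SymmetricAlgebra ℂ B₁ ⊗[ℂ] SymmetricAlgebra ℂ B₂, ∀ φ₁ φ₂,
      SymFunctional.tensor (SymFunctional.S φ₁) (SymFunctional.S φ₂) τ = P.odot φ₁ φ₂ x := by
  induction FreeProd.mem_span_range_ofWord x using Submodule.span_induction with
  | mem x hx =>
    obtain ⟨w, rfl⟩ := hx
    exact P.exists_tensor_eq_odot_ofWord w
  | zero => exact ⟨0, fun φ₁ φ₂ => by rw [map_zero, map_zero]⟩
  | add x y _ _ hx hy =>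
    obtain ⟨τ, hτ⟩ := hx
    obtain ⟨τ', hτ'⟩ := hy
    exact ⟨τ + τ', fun φ₁ φ₂ => by rw [map_add, map_add, hτ, hτ']⟩
  | smul c x _ hx =>
    obtain ⟨τ, hτ⟩ := hx
    exact ⟨c • τ, fun φ₁ φ₂ => by rw [map_smul, map_smul, hτ]⟩

theorem exists_isSigma :
    ∃ σ : FreeProd B₁ B₂ →ₗ[ℂ] SymmetricAlgebra ℂ B₁ ⊗[ℂ] SymmetricAlgebra ℂ B₂, P.IsSigma σ := by
  choose τ hτ using P.exists_tensor_eq_odot (B₁ := B₁) (B₂ := B₂)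
  refine ⟨{ toFun := τ, map_add' := fun x y => ?_, map_smul' := fun c x => ?_ }, ?_⟩
  · exact SymFunctional.ext_tensor_S fun φ₁ φ₂ => by simp only [map_add, hτ]
  · exact SymFunctional.ext_tensor_S fun φ₁ φ₂ => by
      simp only [map_smul, hτ, RingHom.id_apply]
  · intro φ₁ φ₂
    ext x
    exact (hτ x φ₁ φ₂).symm

theorem isSigma_unique
    {σ σ' : FreeProd B₁ B₂ →ₗ[ℂ] SymmetricAlgebra ℂ B₁ ⊗[ℂ] SymmetricAlgebra ℂ B₂}
    (h : P.IsSigma σ) (h' : P.IsSigma σ') : σ = σ' := by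
  ext x
  refine SymFunctional.ext_tensor_S fun φ₁ φ₂ => ?_
  exact DFunLike.congr_fun ((h φ₁ φ₂).symm.trans (h' φ₁ φ₂)) x

end Sigma

end OdotIndependence

/-! ## Powers of curves of matrices -/

section PowersOfCurves

variable {𝔸 : Type*} [NormedRing 𝔸]

/-- The bound `‖1‖ ≤ 1` is assumed instead of `‖1‖ = 1` so that matrices of size zero are covered.
-/
theorem norm_pow_le_of_norm_one_le (h1 : ‖(1 : 𝔸)‖ ≤ 1) {x : 𝔸} {M : ℝ} (hx : ‖x‖ ≤ M) (n : ℕ) :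
    ‖x ^ n‖ ≤ M ^ n := by
  induction n with
  | zero => simpa using h1
  | succ n ih =>
    rw [pow_succ, pow_succ]
    exact (norm_mul_le _ _).trans (mul_le_mul ih hx (norm_nonneg _) ((norm_nonneg _).trans ih))

theorem norm_pow_sub_pow_le_of_norm_le (h1 : ‖(1 : 𝔸)‖ ≤ 1) {x y : 𝔸} {M : ℝ} (hM : 1 ≤ M)
    (hx : ‖x‖ ≤ M) (hy : ‖y‖ ≤ M) (n : ℕ) : ‖x ^ n - y ^ n‖ ≤ n * M ^ n * ‖x - y‖ := by
  induction n with
  | zero => simp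
  | succ n ih =>
    have hM0 : 0 ≤ M := zero_le_one.trans hM
    have h : x ^ (n + 1) - y ^ (n + 1) = x ^ n * (x - y) + (x ^ n - y ^ n) * y := by
      rw [pow_succ, pow_succ]
      noncomm_ring
    rw [h]
    have hx' := norm_pow_le_of_norm_one_le h1 hx n
    calc ‖x ^ n * (x - y) + (x ^ n - y ^ n) * y‖
        ≤ ‖x ^ n‖ * ‖x - y‖ + ‖x ^ n - y ^ n‖ * ‖y‖ :=
          (norm_add_le _ _).trans (add_le_add (norm_mul_le _ _) (norm_mul_le _ _))
      _ ≤ M ^ n * ‖x - y‖ + (n * M ^ n * ‖x - y‖) * M := by gcongr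
      _ ≤ M ^ (n + 1) * ‖x - y‖ + (n * M ^ n * ‖x - y‖) * M := by
          gcongr
          omega
      _ = (n + 1 : ℕ) * M ^ (n + 1) * ‖x - y‖ := by
          push_cast
          ring

theorem tendsto_div_natCast_nhdsWithin_Ici {t : ℝ} (ht : 0 ≤ t) :
    Filter.Tendsto (fun n : ℕ => t / n) Filter.atTop (𝓝[Set.Ici 0] 0) :=
  tendsto_nhdsWithin_iff.2 ⟨tendsto_const_div_atTop_nhds_zero_nat t,
    Filter.Eventually.of_forall fun n => div_nonneg ht n.cast_nonneg⟩

variable [NormedAlgebra ℂ 𝔸]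

theorem eventually_norm_le_of_hasDerivWithinAt (h1 : ‖(1 : 𝔸)‖ ≤ 1) {A : ℝ → 𝔸} {L : 𝔸}
    (h0 : A 0 = 1) (hA : HasDerivWithinAt A L (Set.Ici 0) 0) {t : ℝ} (ht : 0 ≤ t) :
    ∃ K : ℝ, 0 ≤ K ∧ ∀ᶠ n : ℕ in Filter.atTop, ‖A (t / n)‖ ≤ 1 + K / n := by
  obtain ⟨C, hC, hb⟩ := (hA.isBigO_sub.comp_tendsto
    ((tendsto_div_natCast_nhdsWithin_Ici ht).prodMk
      Filter.tendsto_const_pure)).exists_nonneg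
  refine ⟨C * t, mul_nonneg hC ht, ?_⟩
  filter_upwards [hb.bound] with n hn
  simp only [Function.comp_apply, h0, sub_zero] at hn
  rw [Real.norm_of_nonneg (div_nonneg ht n.cast_nonneg)] at hn
  calc ‖A (t / n)‖ = ‖1 + (A (t / n) - 1)‖ := by rw [add_sub_cancel]
    _ ≤ ‖(1 : 𝔸)‖ + ‖A (t / n) - 1‖ := norm_add_le _ _
    _ ≤ 1 + C * t / n := by
      rw [mul_div_assoc]
      exact add_le_add h1 hn

/-- Telescoping bounds the difference by `n M ^ n ‖A (t / n) - A' (t / n)‖` with `M = 1 + (K + K') /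
n`. Here `M ^ n ≤ exp (K + K')`, and tangency makes the norm `o(1 / n)`. -/
theorem tendsto_pow_sub_pow (h1 : ‖(1 : 𝔸)‖ ≤ 1) {A A' : ℝ → 𝔸} {L : 𝔸}
    (h0 : A 0 = 1) (hA : HasDerivWithinAt A L (Set.Ici 0) 0)
    (h0' : A' 0 = 1) (hA' : HasDerivWithinAt A' L (Set.Ici 0) 0) {t : ℝ} (ht : 0 ≤ t) :
    Filter.Tendsto (fun n : ℕ => A (t / n) ^ n - A' (t / n) ^ n) Filter.atTop (𝓝 0) := by
  obtain ⟨K, hK, hb⟩ := eventually_norm_le_of_hasDerivWithinAt h1 h0 hA ht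
  obtain ⟨K', hK', hb'⟩ := eventually_norm_le_of_hasDerivWithinAt h1 h0' hA' ht
  have ho : (fun n : ℕ => A (t / n) - A' (t / n)) =o[Filter.atTop] fun n : ℕ => t / n := by
    have := (hA.sub hA').isLittleO.comp_tendsto (tendsto_div_natCast_nhdsWithin_Ici ht)
    simpa [Function.comp_def, h0, h0'] using this
  have ho' : Filter.Tendsto (fun n : ℕ => Real.exp (K + K') * (n * ‖A (t / n) - A' (t / n)‖))
      Filter.atTop (𝓝 0) := by
    have h2 : (fun n : ℕ => (n : ℝ) * ‖A (t / n) - A' (t / n)‖) =o[Filter.atTop]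
        fun n : ℕ => (n : ℝ) * (t / n) :=
      (Asymptotics.isBigO_refl _ _).mul_isLittleO ho.norm_left
    have h3 : (fun n : ℕ => (n : ℝ) * (t / n)) =O[Filter.atTop] fun _ => (1 : ℝ) := by
      refine Asymptotics.IsBigO.of_bound t ?_
      filter_upwards [Filter.eventually_gt_atTop 0] with n hn
      have hn' : (n : ℝ) ≠ 0 := by exact_mod_cast hn.ne'
      rw [mul_div_cancel₀ _ hn', Real.norm_of_nonneg ht]
      simp
    have h4 := (h2.trans_isBigO h3).tendsto_div_nhds_zero
    simpa using h4.const_mul (Real.exp (K + K'))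
  refine squeeze_zero_norm' ?_ ho'
  filter_upwards [hb, hb', Filter.eventually_gt_atTop 0] with n hn hn' hpos
  have hpos' : (0 : ℝ) < n := by exact_mod_cast hpos
  have hM : 1 ≤ 1 + (K + K') / n := le_add_of_nonneg_right (by positivity)
  refine (norm_pow_sub_pow_le_of_norm_le h1 hM (hn.trans ?_) (hn'.trans ?_) n).trans ?_
  · gcongr
    linarith
  · gcongr
    linarith
  · have : (1 + (K + K') / n) ^ n ≤ Real.exp (K + K') := by
      calc (1 + (K + K') / n) ^ n ≤ Real.exp ((K + K') / n) ^ n := by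
            gcongr
            rw [add_comm]
            exact Real.add_one_le_exp _
        _ = Real.exp (K + K') := by
            rw [← Real.exp_nat_mul, mul_div_cancel₀ _ hpos'.ne']
    calc (n : ℝ) * (1 + (K + K') / n) ^ n * ‖A (t / n) - A' (t / n)‖
        ≤ n * Real.exp (K + K') * ‖A (t / n) - A' (t / n)‖ := by gcongr
      _ = _ := by ring

theorem hasDerivAt_exp_ofReal_smul [CompleteSpace 𝔸] (L : 𝔸) :
    HasDerivAt (fun s : ℝ => NormedSpace.exp ((s : ℂ) • L)) L 0 := by
  have h := (hasDerivAt_exp_smul_const (𝕂 := ℂ) L ((0 : ℝ) : ℂ)).scomp (0 : ℝ)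
    Complex.ofRealCLM.hasDerivAt
  simpa [Function.comp_def] using h

/-- If `A s = 1 + s L + o(s)` for `s ≥ 0`, then `A (t / n) ^ n → exp (t L)`. -/
theorem tendsto_pow_exp_of_hasDerivWithinAt [CompleteSpace 𝔸] (h1 : ‖(1 : 𝔸)‖ ≤ 1) {A : ℝ → 𝔸}
    {L : 𝔸} (h0 : A 0 = 1) (hA : HasDerivWithinAt A L (Set.Ici 0) 0) {t : ℝ} (ht : 0 ≤ t) :
    Filter.Tendsto (fun n : ℕ => A (t / n) ^ n) Filter.atTop
      (𝓝 (NormedSpace.exp ((t : ℂ) • L))) := by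
  have h := tendsto_pow_sub_pow h1 h0 hA
    -- The comparison curve is the exponential itself, whose `n`-th power at `t / n` is exactly `exp
    -- (t L)` for `n > 0`.
    (A' := fun s : ℝ => NormedSpace.exp ((s : ℂ) • L)) (by simp)
    (hasDerivAt_exp_ofReal_smul L).hasDerivWithinAt ht
  have h' := h.add_const (NormedSpace.exp ((t : ℂ) • L))
  rw [zero_add] at h'
  refine h'.congr' ?_
  filter_upwards [Filter.eventually_gt_atTop 0] with n hn
  have hn' : (n : ℂ) ≠ 0 := by exact_mod_cast hn.ne'
  let : NormedAlgebra ℚ 𝔸 := NormedAlgebra.restrictScalars ℚ ℂ 𝔸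
  rw [← NormedSpace.exp_nsmul, ← Nat.cast_smul_eq_nsmul ℂ, smul_smul]
  push_cast
  rw [mul_div_cancel₀ _ hn', sub_add_cancel]

end PowersOfCurves

/-! ### Exponentials of endomorphisms, tested by linear functionals -/

section FiniteDimensional

variable {W : Type*} [AddCommGroup W] [Module ℂ W] [FiniteDimensional ℂ W]

open scoped Matrix.Norms.Operator in
/-- The matrix elements of `exp (t L)` for an endomorphism `L` of a finite-dimensional space. -/
theorem exists_hasSum_exp_of_finiteDimensional (L : Module.End ℂ W) (l : W →ₗ[ℂ] ℂ) (x : W) :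
    ∃ e : ℝ → ℂ,
      (∀ t : ℝ, HasSum (fun n : ℕ => (t : ℂ) ^ n * l ((L ^ n) x) / (n.factorial : ℂ)) (e t)) ∧
      e 0 = l x ∧ HasDerivAt e (l (L x)) 0 ∧
      ∀ A : ℝ → Module.End ℂ W, A 0 = 1 →
        (∀ (m : W →ₗ[ℂ] ℂ) (y : W),
          HasDerivWithinAt (fun s => m (A s y)) (m (L y)) (Set.Ici 0) 0) →
        ∀ t : ℝ, 0 ≤ t →
          Filter.Tendsto (fun n : ℕ => l ((A (t / n) ^ n) x)) Filter.atTop (𝓝 (e t)) := by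
  classical
  let b := Module.finBasis ℂ W
  let Φ := LinearMap.toMatrixAlgEquiv b
  let r : Matrix (Fin (Module.finrank ℂ W)) (Fin (Module.finrank ℂ W)) ℂ →L[ℂ] ℂ :=
    LinearMap.toContinuousLinearMap (l ∘ₗ LinearMap.applyₗ x ∘ₗ Φ.symm.toLinearMap)
  have hr : ∀ a, r a = l (Φ.symm a x) := fun a => rfl
  have hrΦ : ∀ T, r (Φ T) = l (T x) := fun T => by rw [hr, AlgEquiv.symm_apply_apply]
  refine ⟨fun t => r (NormedSpace.exp ((t : ℂ) • Φ L)), fun t => ?_, ?_, ?_, fun A h0 hA t ht => ?_⟩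
  · have h := (NormedSpace.exp_series_hasSum_exp' (𝕂 := ℂ) ((t : ℂ) • Φ L)).mapL r
    convert h using 2 with n
    rw [← map_smul, ← map_pow, ← map_smul, hrΦ, smul_pow]
    · simp only [LinearMap.smul_apply, map_smul, smul_eq_mul]
      ring
    · rfl
  · change r (NormedSpace.exp (((0 : ℝ) : ℂ) • Φ L)) = l x
    rw [Complex.ofReal_zero, zero_smul, NormedSpace.exp_zero, ← map_one Φ, hrΦ]
    rfl
  · rw [← hrΦ]
    exact r.restrictScalars ℝ |>.hasFDerivAt.comp_hasDerivAt (0 : ℝ)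
      (hasDerivAt_exp_ofReal_smul (Φ L))
  · have h1 : ‖(1 : Matrix (Fin (Module.finrank ℂ W)) (Fin (Module.finrank ℂ W)) ℂ)‖ ≤ 1 := by
      cases isEmpty_or_nonempty (Fin (Module.finrank ℂ W))
      · rw [Subsingleton.elim (1 : Matrix (Fin (Module.finrank ℂ W)) _ ℂ) 0, norm_zero]
        exact zero_le_one
      · rw [norm_one]
    have hd : HasDerivWithinAt (fun s => Φ (A s)) (Φ L) (Set.Ici 0) 0 := by
      -- Differentiability is assumed for matrix elements only; a finite sum over matrix units
      -- upgrades it to the matrix-valued curve.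
      have hsum : ∀ T : Module.End ℂ W,
          Φ T = ∑ i, ∑ j, (b.coord i (T (b j))) • Matrix.single i j (1 : ℂ) := by
        intro T
        conv_lhs => rw [Matrix.matrix_eq_sum_single (Φ T)]
        simp [Φ, LinearMap.toMatrixAlgEquiv_apply]
      simp only [hsum]
      exact HasDerivWithinAt.fun_sum fun i _ => HasDerivWithinAt.fun_sum fun j _ =>
        (hA (b.coord i) (b j)).smul_const _
    have h2 := tendsto_pow_exp_of_hasDerivWithinAt h1 (by rw [h0, map_one]) hd ht
    refine ((r.continuous.tendsto _).comp h2).congr fun n => ?_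
    simp only [Function.comp_apply]
    rw [← map_pow, hrΦ]

end FiniteDimensional

/-! ## Derivatives of the functionals `S(φ)` -/

namespace SymFunctional

section Derivative

variable {V : Type u} [AddCommGroup V] [Module ℂ V]

theorem hasDerivAt_S (ψ : V →ₗ[ℂ] ℂ) (x : SymmetricAlgebra ℂ V) :
    HasDerivAt (fun t : ℝ => S ((t : ℂ) • ψ) x) (D ψ x) 0 :=
  (differentiable_S ψ x 0).hasDerivAt

theorem D_algebraMap (ψ : V →ₗ[ℂ] ℂ) (c : ℂ) : D ψ (algebraMap ℂ _ c) = 0 := by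
  refine (hasDerivAt_S ψ _).unique ?_
  simpa [S] using hasDerivAt_const (0 : ℝ) c

theorem D_ι (ψ : V →ₗ[ℂ] ℂ) (v : V) : D ψ (SymmetricAlgebra.ι ℂ V v) = ψ v := by
  refine (hasDerivAt_S ψ _).unique ?_
  simp only [S_ι, LinearMap.smul_apply, smul_eq_mul]
  simpa using (Complex.ofRealCLM.hasDerivAt (x := (0 : ℝ))).mul_const (ψ v)

theorem D_mul (ψ : V →ₗ[ℂ] ℂ) (x y : SymmetricAlgebra ℂ V) :
    D ψ (x * y) = D ψ x * S 0 y + S 0 x * D ψ y := by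
  refine (hasDerivAt_S ψ _).unique ?_
  simpa [S_mul] using (hasDerivAt_S ψ x).fun_mul (hasDerivAt_S ψ y)

theorem D_smul (c : ℂ) (ψ : V →ₗ[ℂ] ℂ) : D (c • ψ) = c • D ψ := by
  ext x
  rw [LinearMap.smul_apply]
  induction x using SymmetricAlgebra.induction with
  | algebraMap r => simp [D_algebraMap]
  | ι v => simp [D_ι]
  | mul a b ha hb =>
    rw [D_mul, D_mul, ha, hb]
    simp only [smul_eq_mul]
    ring
  | add a b ha hb => rw [map_add, map_add, ha, hb, smul_add]

variable {γ : ℝ → V →ₗ[ℂ] ℂ} {ψ : V →ₗ[ℂ] ℂ}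

/-- The derivative of `S` at `0` sees only the tangent of the curve, by the product rule on
generators. The derivative is one-sided because the exponentials are given for nonnegative times. -/
theorem hasDerivWithinAt_S_curve (h0 : γ 0 = 0)
    (hγ : ∀ v, HasDerivWithinAt (fun s => γ s v) (ψ v) (Set.Ici 0) 0) (x : SymmetricAlgebra ℂ V) :
    HasDerivWithinAt (fun s => S (γ s) x) (D ψ x) (Set.Ici 0) 0 := by
  induction x using SymmetricAlgebra.induction with
  | algebraMap r =>
    rw [D_algebraMap]
    simpa [S] using hasDerivWithinAt_const (0 : ℝ) (Set.Ici 0) r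
  | ι v => simpa only [S_ι, D_ι] using hγ v
  | mul a b ha hb =>
    rw [D_mul]
    simpa only [S_mul, h0] using ha.fun_mul hb
  | add a b ha hb => simpa only [map_add] using ha.fun_add hb

theorem hasDerivWithinAt_tensor_S_curve {U : Type v} [AddCommGroup U] [Module ℂ U] (h0 : γ 0 = 0)
    (hγ : ∀ v, HasDerivWithinAt (fun s => γ s v) (ψ v) (Set.Ici 0) 0) (g : U →ₗ[ℂ] ℂ)
    (z : U ⊗[ℂ] SymmetricAlgebra ℂ V) :
    HasDerivWithinAt (fun s => tensor g (S (γ s)) z) (tensor g (D ψ) z) (Set.Ici 0) 0 := by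
  induction z with
  | zero => simpa using hasDerivWithinAt_const (0 : ℝ) (Set.Ici 0) (0 : ℂ)
  | tmul x y =>
    simpa only [tensor_tmul] using (hasDerivWithinAt_S_curve h0 hγ y).const_mul (g x)
  | add a b ha hb => simpa only [map_add] using ha.fun_add hb

theorem hasDerivWithinAt_smul (ψ : V →ₗ[ℂ] ℂ) (v : V) :
    HasDerivWithinAt (fun s : ℝ => ((s : ℂ) • ψ) v) (ψ v) (Set.Ici 0) 0 := by
  simpa only [S_ι, D_ι] using (hasDerivAt_S ψ (SymmetricAlgebra.ι ℂ V v)).hasDerivWithinAt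

end Derivative

/-! ## Convolution operators -/

section ConvOp

variable {V : Type u} [AddCommGroup V] [Module ℂ V]
  (δ : V →ₗ[ℂ] SymmetricAlgebra ℂ V ⊗[ℂ] SymmetricAlgebra ℂ V)

/-- The operator `(id ⊗ f) ∘ S(δ)` of convolution by `f`. -/
noncomputable def convOp (f : SymmetricAlgebra ℂ V →ₗ[ℂ] ℂ) :
    Module.End ℂ (SymmetricAlgebra ℂ V) :=
  (TensorProduct.rid ℂ _).toLinearMap ∘ₗ f.lTensor _ ∘ₗ comul δ

theorem apply_convOp (g f : SymmetricAlgebra ℂ V →ₗ[ℂ] ℂ) (x : SymmetricAlgebra ℂ V) :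
    g (convOp δ f x) = tensor g f (comul δ x) := by
  simp only [convOp, LinearMap.comp_apply]
  generalize comul δ x = z
  induction z with
  | zero => simp
  | tmul a b => simp [mul_comm]
  | add a b ha hb => simp only [map_add, ha, hb]

theorem convPow_eq_convOp_pow (f : SymmetricAlgebra ℂ V →ₗ[ℂ] ℂ) (n : ℕ)
    (x : SymmetricAlgebra ℂ V) : convPow δ f n x = S 0 ((convOp δ f ^ n) x) := by
  induction n generalizing x with
  | zero => rfl
  | succ n ih =>
    rw [pow_succ, Module.End.mul_apply, ← ih, apply_convOp]
    rfl

theorem convOp_smul (c : ℂ) (f : SymmetricAlgebra ℂ V →ₗ[ℂ] ℂ) :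
    convOp δ (c • f) = c • convOp δ f := by
  ext x
  simp [convOp, LinearMap.lTensor_smul]

/-- The coproduct of `x` is a finite sum of `a ⊗ b`; the span of the left legs `a` serves for all
`f` at once. -/
theorem exists_finiteDimensional_convOp_mem (x : SymmetricAlgebra ℂ V) :
    ∃ F : Submodule ℂ (SymmetricAlgebra ℂ V), FiniteDimensional ℂ F ∧ ∀ f, convOp δ f x ∈ F := by
  simp only [convOp, LinearMap.comp_apply]
  generalize comul δ x = z
  induction z with
  | zero => exact ⟨⊥, inferInstance, fun f => by simp⟩
  | tmul a b =>
    refine ⟨Submodule.span ℂ {a}, inferInstance, fun f => ?_⟩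
    simpa using Submodule.smul_mem _ _ (Submodule.mem_span_singleton_self a)
  | add a b ha hb =>
    obtain ⟨F, _, hF⟩ := ha
    obtain ⟨G, _, hG⟩ := hb
    refine ⟨F ⊔ G, inferInstance, fun f => ?_⟩
    simp only [map_add]
    exact add_mem (Submodule.mem_sup_left (hF f)) (Submodule.mem_sup_right (hG f))

/-- The span of the translates of `x` by the functionals `S(φ)`. -/
noncomputable def translates (x : SymmetricAlgebra ℂ V) : Submodule ℂ (SymmetricAlgebra ℂ V) :=
  Submodule.span ℂ (Set.range fun φ : V →ₗ[ℂ] ℂ => convOp δ (S φ) x)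

instance (x : SymmetricAlgebra ℂ V) : FiniteDimensional ℂ (translates δ x) := by
  obtain ⟨F, _, hF⟩ := exists_finiteDimensional_convOp_mem δ x
  refine Submodule.finiteDimensional_of_le (S₂ := F) (Submodule.span_le.2 ?_)
  rintro _ ⟨φ, rfl⟩
  exact hF _

/-- `c` is an associative product of functionals on `V` with the unit `0` which is determined by
`δ`. -/
structure IsConvolution (c : (V →ₗ[ℂ] ℂ) → (V →ₗ[ℂ] ℂ) → (V →ₗ[ℂ] ℂ)) : Prop where
  tensor_eq : ∀ φ ρ v, tensor (S φ) (S ρ) (δ v) = c φ ρ v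
  assoc : ∀ φ ρ τ, c (c φ ρ) τ = c φ (c ρ τ)
  zero_left : ∀ φ, c 0 φ = φ
  zero_right : ∀ φ, c φ 0 = φ

namespace IsConvolution

variable {δ} {c : (V →ₗ[ℂ] ℂ) → (V →ₗ[ℂ] ℂ) → (V →ₗ[ℂ] ℂ)} (hc : IsConvolution δ c)
include hc

/-- Both sides are unital homomorphisms in `x` that agree on `V`. Together with `ext_S` this
replaces a proof that `S(δ)` is coassociative and counital. -/
theorem S_convOp (φ ρ : V →ₗ[ℂ] ℂ) (x : SymmetricAlgebra ℂ V) :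
    S φ (convOp δ (S ρ) x) = S (c φ ρ) x := by
  have h : (tensorAlgHom φ ρ).comp (SymmetricAlgebra.lift δ) = SymmetricAlgebra.lift (c φ ρ) := by
    refine SymmetricAlgebra.algHom_ext (LinearMap.ext fun v => ?_)
    simp [tensorAlgHom_apply, hc.tensor_eq]
  rw [apply_convOp, ← tensorAlgHom_apply]
  exact DFunLike.congr_fun h x

theorem convOp_convOp (φ ρ : V →ₗ[ℂ] ℂ) (x : SymmetricAlgebra ℂ V) :
    convOp δ (S φ) (convOp δ (S ρ) x) = convOp δ (S (c φ ρ)) x :=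
  ext_S fun τ => by rw [hc.S_convOp, hc.S_convOp, hc.S_convOp, hc.assoc]

theorem convOp_S_zero (x : SymmetricAlgebra ℂ V) : convOp δ (S 0) x = x :=
  ext_S fun τ => by rw [hc.S_convOp, hc.zero_right]

theorem mem_translates (x : SymmetricAlgebra ℂ V) : x ∈ translates δ x :=
  Submodule.subset_span ⟨0, hc.convOp_S_zero x⟩

theorem convOp_S_mem_translates (φ : V →ₗ[ℂ] ℂ) {x y : SymmetricAlgebra ℂ V}
    (hy : y ∈ translates δ x) : convOp δ (S φ) y ∈ translates δ x := by
  induction hy using Submodule.span_induction with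
  | mem y hy =>
    obtain ⟨ρ, rfl⟩ := hy
    exact Submodule.subset_span ⟨c φ ρ, (hc.convOp_convOp φ ρ x).symm⟩
  | zero => rw [map_zero]; exact zero_mem _
  | add y z _ _ hy hz => rw [map_add]; exact add_mem hy hz
  | smul a y _ hy => rw [map_smul]; exact Submodule.smul_mem _ a hy

/-- A functional vanishing on the translates vanishes along `s ↦ convOp δ (S (s ψ)) y`, hence on the
derivative of this curve at `0`. -/
theorem convOp_D_mem_translates (ψ : V →ₗ[ℂ] ℂ) {x y : SymmetricAlgebra ℂ V}
    (hy : y ∈ translates δ x) : convOp δ (D ψ) y ∈ translates δ x := by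
  by_contra hn
  obtain ⟨g, hg, hker⟩ := Submodule.exists_le_ker_of_notMem hn
  apply hg
  rw [apply_convOp]
  have h := hasDerivWithinAt_tensor_S_curve (γ := fun s : ℝ => (s : ℂ) • ψ) (by simp)
    (hasDerivWithinAt_smul ψ) g (comul δ y)
  have hz : ∀ s : ℝ, tensor g (S ((s : ℂ) • ψ)) (comul δ y) = 0 := fun s => by
    rw [← apply_convOp]
    exact hker (hc.convOp_S_mem_translates _ hy)
  simp only [hz] at h
  exact (uniqueDiffWithinAt_Ici (0 : ℝ)).eq_deriv _ h (hasDerivWithinAt_const _ _ _)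

theorem S_zero_convOp_D (ψ : V →ₗ[ℂ] ℂ) (x : SymmetricAlgebra ℂ V) :
    S 0 (convOp δ (D ψ) x) = D ψ x := by
  rw [apply_convOp]
  have h := hasDerivWithinAt_tensor_S_curve (γ := fun s : ℝ => (s : ℂ) • ψ) (by simp)
    (hasDerivWithinAt_smul ψ) (S 0) (comul δ x)
  simp only [← apply_convOp δ (S 0) (S _), hc.S_convOp, hc.zero_left] at h
  exact (uniqueDiffWithinAt_Ici (0 : ℝ)).eq_deriv _ h (hasDerivAt_S ψ x).hasDerivWithinAt

/-- The convolution exponential, its derivative at `0`, and its approximation by convolution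
powers. -/
theorem exists_hasSum_convPow (ψ : V →ₗ[ℂ] ℂ) (x : SymmetricAlgebra ℂ V) :
    ∃ e : ℝ → ℂ,
      (∀ t : ℝ, HasSum (fun n : ℕ => convPow δ (D ((t : ℂ) • ψ)) n x / (n.factorial : ℂ)) (e t)) ∧
      e 0 = S 0 x ∧ HasDerivAt e (D ψ x) 0 ∧
      ∀ γ : ℝ → V →ₗ[ℂ] ℂ, γ 0 = 0 →
        (∀ v, HasDerivWithinAt (fun s => γ s v) (ψ v) (Set.Ici 0) 0) →
        ∀ t : ℝ, 0 ≤ t → Filter.Tendsto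
          (fun n : ℕ => S 0 ((convOp δ (S (γ (t / n))) ^ n) x)) Filter.atTop (𝓝 (e t)) := by
  let L : Module.End ℂ (translates δ x) :=
    (convOp δ (D ψ)).restrict fun y hy => hc.convOp_D_mem_translates ψ hy
  let T : (V →ₗ[ℂ] ℂ) → Module.End ℂ (translates δ x) := fun φ =>
    (convOp δ (S φ)).restrict fun y hy => hc.convOp_S_mem_translates φ hy
  obtain ⟨e, hsum, h0, hderiv, htend⟩ := exists_hasSum_exp_of_finiteDimensional L
    (S 0 ∘ₗ (translates δ x).subtype) ⟨x, hc.mem_translates x⟩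
  refine ⟨e, fun t => ?_, h0, ?_, fun γ hγ0 hγ t ht => ?_⟩
  · convert hsum t using 2 with n
    rw [convPow_eq_convOp_pow, D_smul, convOp_smul, smul_pow, LinearMap.smul_apply, map_smul,
      smul_eq_mul, Module.End.pow_restrict]
    rfl
  · convert hderiv using 1
    exact (hc.S_zero_convOp_D ψ x).symm
  · refine (htend (fun s => T (γ s)) ?_ (fun m y => ?_) t ht).congr fun n => ?_
    · ext y
      simp only [hγ0]
      exact hc.convOp_S_zero y
    -- Functionals on the subspace extend to the whole symmetric algebra, where the derivative along
    -- `γ` is known.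
    · obtain ⟨g, rfl⟩ := m.exists_extend
      have h := hasDerivWithinAt_tensor_S_curve hγ0 hγ g (comul δ y)
      simp only [← apply_convOp] at h
      exact h
    · simp only [T]
      rw [Module.End.pow_restrict]
      rfl

end IsConvolution

end ConvOp

end SymFunctional

/-! ## Convolution of functionals on a dual semigroup -/

namespace OdotIndependence

variable (P : OdotIndependence.{u})

section

variable {B : Type u}
  [NonUnitalRing B] [Module ℂ B] [IsScalarTower ℂ B B] [SMulCommClass ℂ B B]
  [StarRing B] [StarModule ℂ B] (H : DualSemigroup B)

/-- (A3) for `Δ ⨿ id` and `id ⨿ Δ` reduces this to (A2) and coassociativity. -/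
theorem conv_assoc (φ₁ φ₂ φ₃ : B →ₗ[ℂ] ℂ) :
    P.conv H (P.conv H φ₁ φ₂) φ₃ = P.conv H φ₁ (P.conv H φ₂ φ₃) := by
  ext b
  have h1 := P.odot_comp (P.odot φ₁ φ₂) φ₃ (H.Δ : B →ₙₐ[ℂ] FreeProd B B)
    (NonUnitalAlgHom.id ℂ B) (H.Δ b)
  have h2 := P.odot_comp φ₁ (P.odot φ₂ φ₃) (NonUnitalAlgHom.id ℂ B)
    (H.Δ : B →ₙₐ[ℂ] FreeProd B B) (H.Δ b)
  rw [P.odot_assoc, H.coassoc] at h1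
  exact h1.trans h2.symm

/-- The zero functional is its own pullback along the zero homomorphism, and `0 ⨿ id` factors as
`inr ∘ (0 ⊔ id)`; the counit axiom and (A1) finish. -/
theorem zero_conv (φ : B →ₗ[ℂ] ℂ) : P.conv H 0 φ = φ := by
  ext b
  have h := P.odot_comp (0 : B →ₗ[ℂ] ℂ) φ (0 : B →ₙₐ[ℂ] B) (NonUnitalAlgHom.id ℂ B) (H.Δ b)
  have hm : FreeProd.map (0 : B →ₙₐ[ℂ] B) (NonUnitalAlgHom.id ℂ B) =
      FreeProd.inr.comp (FreeProd.lift (0 : B →ₙₐ[ℂ] B) (NonUnitalAlgHom.id ℂ B)) :=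
    FreeProd.hom_ext (fun a => by simp) (fun a => by simp)
  rw [hm, NonUnitalAlgHom.comp_apply, H.counit_left, P.odot_inr, LinearMap.zero_comp] at h
  exact h

theorem conv_zero (φ : B →ₗ[ℂ] ℂ) : P.conv H φ 0 = φ := by
  ext b
  have h := P.odot_comp φ (0 : B →ₗ[ℂ] ℂ) (NonUnitalAlgHom.id ℂ B) (0 : B →ₙₐ[ℂ] B) (H.Δ b)
  have hm : FreeProd.map (NonUnitalAlgHom.id ℂ B) (0 : B →ₙₐ[ℂ] B) =
      FreeProd.inl.comp (FreeProd.lift (NonUnitalAlgHom.id ℂ B) (0 : B →ₙₐ[ℂ] B)) :=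
    FreeProd.hom_ext (fun a => by simp) (fun a => by simp)
  rw [hm, NonUnitalAlgHom.comp_apply, H.counit_right, P.odot_inl, LinearMap.zero_comp] at h
  exact h

variable {P} {σ : FreeProd B B →ₗ[ℂ] SymmetricAlgebra ℂ B ⊗[ℂ] SymmetricAlgebra ℂ B}

theorem IsSigma.isConvolution (hσ : P.IsSigma σ) : SymFunctional.IsConvolution
    (σ ∘ₗ ((H.Δ : B →ₙₐ[ℂ] FreeProd B B) : B →ₗ[ℂ] FreeProd B B)) (P.conv H) where
  tensor_eq φ ρ v := (DFunLike.congr_fun (hσ φ ρ) (H.Δ v)).symm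
  assoc := P.conv_assoc H
  zero_left := P.zero_conv H
  zero_right := P.conv_zero H

theorem IsSigma.S_convPow (hσ : P.IsSigma σ) (φ : B →ₗ[ℂ] ℂ) (n : ℕ)
    (x : SymmetricAlgebra ℂ B) : SymFunctional.S (P.convPow H φ n) x =
      SymFunctional.S 0 ((SymFunctional.convOp
        (σ ∘ₗ ((H.Δ : B →ₙₐ[ℂ] FreeProd B B) : B →ₗ[ℂ] FreeProd B B))
        (SymFunctional.S φ) ^ n) x) := by
  induction n generalizing x with
  | zero => rfl
  | succ n ih =>
    rw [pow_succ, Module.End.mul_apply, ← ih, (hσ.isConvolution H).S_convOp]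
    rfl

theorem IsSigma.convPow_apply (hσ : P.IsSigma σ) (φ : B →ₗ[ℂ] ℂ) (n : ℕ) (b : B) :
    P.convPow H φ n b = SymFunctional.S 0 ((SymFunctional.convOp
        (σ ∘ₗ ((H.Δ : B →ₙₐ[ℂ] FreeProd B B) : B →ₗ[ℂ] FreeProd B B))
        (SymFunctional.S φ) ^ n) (SymmetricAlgebra.ι ℂ B b)) := by
  rw [← hσ.S_convPow, SymFunctional.S_ι]

theorem IsConvExp.hasSum {ψ φ : B →ₗ[ℂ] ℂ} (h : P.IsConvExp H ψ φ) (hσ : P.IsSigma σ) (b : B) :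
    HasSum (fun n : ℕ => SymFunctional.convPow
        (σ ∘ₗ ((H.Δ : B →ₙₐ[ℂ] FreeProd B B) : B →ₗ[ℂ] FreeProd B B))
        (SymFunctional.D ψ) n (SymmetricAlgebra.ι ℂ B b) / (n.factorial : ℂ)) (φ b) := by
  obtain ⟨σ', hσ', hsum⟩ := h
  obtain rfl := P.isSigma_unique hσ hσ'
  exact hsum b

theorem IsConvExp.unique {ψ φ φ' : B →ₗ[ℂ] ℂ} (h : P.IsConvExp H ψ φ)
    (h' : P.IsConvExp H ψ φ') : φ = φ' := by
  obtain ⟨σ, hσ⟩ := P.exists_isSigma (B₁ := B) (B₂ := B)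
  ext b
  exact (h.hasSum H hσ b).unique (h'.hasSum H hσ b)

variable (P)

theorem existsUnique_isConvExp (ψ : B →ₗ[ℂ] ℂ) : ∃! φ : B →ₗ[ℂ] ℂ, P.IsConvExp H ψ φ := by
  obtain ⟨σ, hσ⟩ := P.exists_isSigma (B₁ := B) (B₂ := B)
  have h : ∀ b : B, ∃ a : ℂ, HasSum (fun n : ℕ => SymFunctional.convPow
        (σ ∘ₗ ((H.Δ : B →ₙₐ[ℂ] FreeProd B B) : B →ₗ[ℂ] FreeProd B B))
        (SymFunctional.D ψ) n (SymmetricAlgebra.ι ℂ B b) / (n.factorial : ℂ)) a := by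
    intro b
    obtain ⟨e, he, -⟩ := (hσ.isConvolution H).exists_hasSum_convPow ψ (SymmetricAlgebra.ι ℂ B b)
    exact ⟨e 1, by simpa using he 1⟩
  choose a ha using h
  refine ⟨{ toFun := a, map_add' := fun b b' => ?_, map_smul' := fun c b => ?_ }, ⟨σ, hσ, ha⟩,
    fun φ hφ => hφ.unique H ⟨σ, hσ, ha⟩⟩
  · refine (ha (b + b')).unique ?_
    simpa only [map_add, add_div] using (ha b).add (ha b')
  · refine (ha (c • b)).unique ?_
    simpa only [map_smul, smul_eq_mul, mul_div_assoc, RingHom.id_apply] using (ha b).mul_left c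

variable {P} {ψ : B →ₗ[ℂ] ℂ} {γ : ℝ → B →ₗ[ℂ] ℂ}
  (hγ : ∀ t : ℝ, 0 ≤ t → P.IsConvExp H ((t : ℂ) • ψ) (γ t))
include hγ

/-- On the generator `ι b`, `S 0` is zero and `D ψ` is `ψ b`; these are the value and the derivative
at `0` of the matrix element that sums the series. -/
theorem IsConvExp.zero_and_hasDerivWithinAt (b : B) :
    γ 0 b = 0 ∧ HasDerivWithinAt (fun s => γ s b) (ψ b) (Set.Ici 0) 0 := by
  obtain ⟨σ, hσ⟩ := P.exists_isSigma (B₁ := B) (B₂ := B)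
  obtain ⟨e, he, he0, hd, -⟩ :=
    (hσ.isConvolution H).exists_hasSum_convPow ψ (SymmetricAlgebra.ι ℂ B b)
  have heq : ∀ t : ℝ, 0 ≤ t → γ t b = e t := fun t ht =>
    ((hγ t ht).hasSum H hσ b).unique (he t)
  rw [SymFunctional.D_ι] at hd
  refine ⟨?_, hd.hasDerivWithinAt.congr (fun t ht => heq t ht) (heq 0 le_rfl)⟩
  rw [heq 0 le_rfl, he0, SymFunctional.S_ι, LinearMap.zero_apply]

theorem IsConvExp.tendsto_convPow {α : ℝ → B →ₗ[ℂ] ℂ} (hα0 : α 0 = 0)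
    (hα : ∀ b, HasDerivWithinAt (fun s => α s b) (ψ b) (Set.Ici 0) 0) {t : ℝ} (ht : 0 ≤ t) (b : B) :
    Filter.Tendsto (fun n : ℕ => P.convPow H (α (t / n)) n b) Filter.atTop (𝓝 (γ t b)) := by
  obtain ⟨σ, hσ⟩ := P.exists_isSigma (B₁ := B) (B₂ := B)
  obtain ⟨e, he, -, -, htend⟩ :=
    (hσ.isConvolution H).exists_hasSum_convPow ψ (SymmetricAlgebra.ι ℂ B b)
  rw [((hγ t ht).hasSum H hσ b).unique (he t)]
  simpa only [hσ.convPow_apply H] using htend α hα0 hα t ht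

end

end OdotIndependence

theorem mainTheorem4 (P : OdotIndependence.{u}) {B C : Type u}
    [NonUnitalRing B] [Module ℂ B] [IsScalarTower ℂ B B] [SMulCommClass ℂ B B]
    [StarRing B] [StarModule ℂ B]
    [NonUnitalRing C] [Module ℂ C] [IsScalarTower ℂ C C] [SMulCommClass ℂ C C]
    [StarRing C] [StarModule ℂ C]
    (H : DualSemigroup B) (K : DualSemigroup C) (κ : C →⋆ₙₐ[ℂ] B) (ψ : B →ₗ[ℂ] ℂ) :
    (∀ t : ℝ, 0 ≤ t → ∃! γ : B →ₗ[ℂ] ℂ, P.IsConvExp H ((t : ℂ) • ψ) γ) ∧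
    (∀ t : ℝ, 0 ≤ t → ∃! φ : C →ₗ[ℂ] ℂ,
      P.IsConvExp K ((t : ℂ) • (ψ ∘ₗ ((κ : C →ₙₐ[ℂ] B) : C →ₗ[ℂ] B))) φ) ∧
    ∀ (γ : ℝ → (B →ₗ[ℂ] ℂ)) (φ : ℝ → (C →ₗ[ℂ] ℂ)),
      (∀ t : ℝ, 0 ≤ t → P.IsConvExp H ((t : ℂ) • ψ) (γ t)) →
      (∀ t : ℝ, 0 ≤ t →
        P.IsConvExp K ((t : ℂ) • (ψ ∘ₗ ((κ : C →ₙₐ[ℂ] B) : C →ₗ[ℂ] B))) (φ t)) →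
      ∀ t : ℝ, 0 ≤ t → ∀ c : C,
        Filter.Tendsto (fun n : ℕ =>
            P.convPow K (γ (t / n) ∘ₗ ((κ : C →ₙₐ[ℂ] B) : C →ₗ[ℂ] B)) n c)
          Filter.atTop (𝓝 (φ t c)) := by
  refine ⟨fun t _ => P.existsUnique_isConvExp H _, fun t _ => P.existsUnique_isConvExp K _,
    fun γ φ hγ hφ t ht c => ?_⟩
  exact OdotIndependence.IsConvExp.tendsto_convPow K hφ
    (α := fun s => γ s ∘ₗ ((κ : C →ₙₐ[ℂ] B) : C →ₗ[ℂ] B))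
    (LinearMap.ext fun a => (OdotIndependence.IsConvExp.zero_and_hasDerivWithinAt H hγ _).1)
    (fun a => (OdotIndependence.IsConvExp.zero_and_hasDerivWithinAt H hγ _).2) ht c
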